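/- **Proposition 1.** Let $X=[x_1,\dots,x_M]\in\mathbb R^{N\times M}$, $\hat C=\frac1M\sum_{m}x_mx_m^\top$, $\alpha,\beta>0$, $\gamma\ge 0$, $\delta\in\mathbb R$, $\tilde\lambda\in\mathbb R^{\tilde N}$, and let $g:\mathbb R\to\mathbb R$ be concave and differentiable on $(0,\infty)$. For $\lambda\in\mathbb R^n$ put $c_g(\lambda)=\frac1n\sum_{i=1}^n g(\lambda_i)$. Write $\|\cdot\|_1$ for the entrywise $\ell_1$ norm and $\|\cdot\|_F$ for the Frobenius norm. Given a set $\mathcal S\subset\mathbb R^{N\times N}$ of symmetric matrices, consider $$\min_{S,V,\lambda}\ \phi(S,V,\lambda)=\mathrm{tr}(\hat CS)-\log\det(\mathrm{diag}(\lambda))+\alpha\|S\|_1+\tfrac{\beta}{2}\|S-V\mathrm{diag}(\lambda)V^\top\|_F^2+\gamma c_g(\lambda)$$ subject to $S\in\mathcal S$, $V^\top V=I$, $\lambda\in\mathcal L:=\{\lambda\in\mathbb R^N:\lambda_i>0\ \forall i,\ c_g(\lambda)\ge c_g(\tilde\lambda)-\delta\}$. A feasible point $y$ is *stationary* if for every $d$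 in the (Bouligand) tangent cone of the feasible set at $y$ the one-sided directional derivative $\phi'(y;d)$ exists and is $\ge 0$; let $\mathcal Y^*$ be the set of stationary points. Let $(S^{(t)},V^{(t)},\lambda^{(t)})_{t\ge0}$ be any sequence with $\lambda^{(0)}>0$ entrywise such that for all $t\ge 0$: 1. $S^{(t+1)}$ is obtained in one of the two ways (a), (b) below, the same for all $t$; 2. $V^{(t+1)}$ maximizes $\mathrm{tr}(V^\top S^{(t+1)}V\,\mathrm{diag}(\lambda^{(t)}))$ over $V^\top V=I$ (for instance, an orthonormal eigenbasis of $S^{(t+1)}$ ordered consistently with $\lambda^{(t)}$); 3. $\lambda^{(t+1)}$ minimizes $-\sum_j\log\lambda_j+\frac\beta2\|\lambda-\hat\lambda\|_2^2+\gamma\nabla c_g(\lambda^{(t)})^\top\lambda$ over $\lambda\in\mathcal L$, where $\hat\lambda$ is the diagonal of $V^{(t+1)\top}S^{(t+1)}V^{(t+1)}$. (a) $\mathcal S$ is closed and convex, and $S^{(t+1)}$ minimizes $\mathrm{tr}(\hat CS)+\alpha\|S\|_1+\frac\beta2\|S-V^{(t)}\mathrm{diag}(\lambda^{(t)})V^{(t)\top}\|_F^2$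 over $S\in\mathcal S$. (b) $\mathcal S=\{\mathscr S s: s\in\mathbb R^m,\ s\ge0\}$ for an injective linear map $\mathscr S$ from $\mathbb R^m$ to the symmetric $N\times N$ matrices, for which there is a fixed (sign) matrix $H$ with $\|\mathscr Ss\|_1=\mathrm{tr}((\mathscr Ss)H)$ for all $s\ge0$; and $S^{(t+1)}=\mathscr Ss^{(t+1)}$, where $$s^{(t+1)}=\Big(s^{(t)}-\tfrac{1}{\|\mathscr S\|_2^2}\big(\mathscr S^*(\mathscr Ss^{(t)})-z^{(t)}\big)\Big)^+,\qquad z^{(t)}=\mathscr S^*\big(V^{(t)}\mathrm{diag}(\lambda^{(t)})V^{(t)\top}-\beta^{-1}(\hat C+\alpha H)\big),$$ $\mathscr S^*$ is the adjoint for the Euclidean and Frobenius inner products, $\|\mathscr S\|_2^2=\sup_{\|s\|_2=1}\|\mathscr Ss\|_F^2$, and $(\cdot)^+=\max(\cdot,0)$ entrywise. Then the sequence converges to the set of stationary points: the Euclidean distance from $(S^{(t)},V^{(t)},\lambda^{(t)})$ to $\mathcal Y^*$ tends to $0$ as $t\to\infty$; moreover the sequence has at least one limit point, and every limit point belongs to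 $\mathcal Y^*$. -/

import Mathlib

open Filter Matrix

noncomputable section

namespace MotifGL

/-- Squared Frobenius norm. -/
def frobSq {N : ℕ} (A : Matrix (Fin N) (Fin N) ℝ) : ℝ := ∑ i, ∑ j, A i j ^ 2

/-- Entrywise `ℓ¹` norm of a matrix. -/
def l1Norm {N : ℕ} (A : Matrix (Fin N) (Fin N) ℝ) : ℝ := ∑ i, ∑ j, |A i j|

/-- Empirical covariance `(1/M) ∑ₘ xₘ xₘᵀ` of the columns of `X`. -/
def empCov {N M : ℕ} (X : Matrix (Fin N) (Fin M) ℝ) : Matrix (Fin N) (Fin N) ℝ :=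
  (1 / (M : ℝ)) • ∑ m, vecMulVec (fun i => X i m) (fun i => X i m)

/-- `c_g(l) = (1/n) ∑ᵢ g(lᵢ)`. -/
def cg (g : ℝ → ℝ) {n : ℕ} (l : Fin n → ℝ) : ℝ := (1 / (n : ℝ)) * ∑ i, g (l i)

/-- The linear majorizer `u(l, l₀) = ∇c_g(l₀)ᵀ l` of `c_g` (constant terms omitted). -/
def majorizer (g : ℝ → ℝ) {n : ℕ} (l l₀ : Fin n → ℝ) : ℝ := fderiv ℝ (cg g) l₀ l

/-- The triples `(S, V, l)`. -/
abbrev Point (N : ℕ) : Type :=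
  Matrix (Fin N) (Fin N) ℝ × Matrix (Fin N) (Fin N) ℝ × (Fin N → ℝ)

/-- Euclidean distance between two triples (Frobenius norm on the matrix blocks). -/
def pointDist {N : ℕ} (x y : Point N) : ℝ :=
  √(frobSq (x.1 - y.1) + frobSq (x.2.1 - y.2.1) + ∑ i, (x.2.2 i - y.2.2 i) ^ 2)

/-- The data of the relaxed problem, without the feasible set of graph-shift operators:
signals, weights, tolerance, test function, and spectrum of the reference graph. -/
structure Data (N M K : ℕ) where
  X : Matrix (Fin N) (Fin M) ℝ
  α : ℝ
  β : ℝ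
  γ : ℝ
  δ : ℝ
  g : ℝ → ℝ
  lref : Fin K → ℝ

namespace Data

variable {N M K : ℕ} (P : Data N M K)

/-- The objective of the relaxed problem. -/
def objective (x : Point N) : ℝ :=
  trace (empCov P.X * x.1) - Real.log (det (diagonal x.2.2)) + P.α * l1Norm x.1
    + P.β / 2 * frobSq (x.1 - x.2.1 * diagonal x.2.2 * x.2.1ᵀ) + P.γ * cg P.g x.2.2

/-- Admissible spectra: positive (the domain of the log-determinant), and satisfying the
similarity constraint. -/
def spectra : Set (Fin N → ℝ) :=
  {l | (∀ i, 0 < l i) ∧ cg P.g l ≥ cg P.g P.lref - P.δ}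

/-- Feasible set of the relaxed problem, `𝒮` being the set of admissible shift operators. -/
def feasible (𝒮 : Set (Matrix (Fin N) (Fin N) ℝ)) : Set (Point N) :=
  {x | x.1 ∈ 𝒮 ∧ x.2.1ᵀ * x.2.1 = 1 ∧ x.2.2 ∈ P.spectra}

/-- Stationary points: feasible points at which the one-sided directional derivative of the
objective exists and is nonnegative along every direction of the (Bouligand) tangent cone of the
feasible set. -/
def stationary (𝒮 : Set (Matrix (Fin N) (Fin N) ℝ)) : Set (Point N) :=
  {x | x ∈ P.feasible 𝒮 ∧ ∀ d ∈ posTangentConeAt (P.feasible 𝒮) x,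
    ∃ r : ℝ, 0 ≤ r ∧
      HasDerivWithinAt (fun h : ℝ => P.objective (x + h • d)) r (Set.Ici 0) 0}

/-- Objective of Step 1, given `V` and `l`. -/
def step1Obj (V : Matrix (Fin N) (Fin N) ℝ) (l : Fin N → ℝ) (S : Matrix (Fin N) (Fin N) ℝ) : ℝ :=
  trace (empCov P.X * S) + P.α * l1Norm S + P.β / 2 * frobSq (S - V * diagonal l * Vᵀ)

/-- Objective of Step 3, given `S`, `V` and the previous spectrum `l₀`. -/
def step3Obj (S V : Matrix (Fin N) (Fin N) ℝ) (l₀ l : Fin N → ℝ) : ℝ :=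
  -∑ j, Real.log (l j) + P.β / 2 * ∑ j, (l j - (Vᵀ * S * V) j j) ^ 2 + P.γ * majorizer P.g l l₀

/-- `Sn` solves Step 1 exactly, given the previous iterate `x`. -/
def IsExactStep1 (𝒮 : Set (Matrix (Fin N) (Fin N) ℝ)) (x : Point N)
    (Sn : Matrix (Fin N) (Fin N) ℝ) : Prop :=
  Sn ∈ 𝒮 ∧ IsMinOn (P.step1Obj x.2.1 x.2.2) 𝒮 Sn

/-- `Vn` solves Step 2, i.e. maximizes `tr(Vᵀ S V diag(l))` over orthogonal `V`. An orthonormal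
eigenbasis of the symmetric matrix `S`, its columns ordered consistently with `l`, does so. -/
def IsStep2 (S : Matrix (Fin N) (Fin N) ℝ) (l : Fin N → ℝ)
    (Vn : Matrix (Fin N) (Fin N) ℝ) : Prop :=
  Vn ∈ {V : Matrix (Fin N) (Fin N) ℝ | Vᵀ * V = 1} ∧
    IsMaxOn (fun V : Matrix (Fin N) (Fin N) ℝ => trace (Vᵀ * S * V * diagonal l))
      {V | Vᵀ * V = 1} Vn

/-- `ln` solves Step 3. -/
def IsStep3 (S V : Matrix (Fin N) (Fin N) ℝ) (l₀ ln : Fin N → ℝ) : Prop :=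
  ln ∈ P.spectra ∧ IsMinOn (P.step3Obj S V l₀) P.spectra ln

/-- Sequences generated by the three-block algorithm with Step 1 solved exactly. -/
def IsExactRun (𝒮 : Set (Matrix (Fin N) (Fin N) ℝ)) (x : ℕ → Point N) : Prop :=
  (∀ i, 0 < (x 0).2.2 i) ∧ ∀ t,
    P.IsExactStep1 𝒮 (x t) (x (t + 1)).1 ∧
    IsStep2 (x (t + 1)).1 (x t).2.2 (x (t + 1)).2.1 ∧
    P.IsStep3 (x (t + 1)).1 (x (t + 1)).2.1 (x t).2.2 (x (t + 1)).2.2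

/-- The adjoint `𝓢*` for the Euclidean and Frobenius inner products:
`(𝓢* Y)ₖ = ⟨𝓢 eₖ, Y⟩`. -/
def adj {m : ℕ} (𝓢 : (Fin m → ℝ) →ₗ[ℝ] Matrix (Fin N) (Fin N) ℝ)
    (Y : Matrix (Fin N) (Fin N) ℝ) : Fin m → ℝ :=
  fun k => ∑ i, ∑ j, 𝓢 (Pi.single k 1) i j * Y i j

/-- Squared operator norm `sup_{‖s‖₂ = 1} ‖𝓢 s‖_F²`. -/
def opNormSq {m : ℕ} (𝓢 : (Fin m → ℝ) →ₗ[ℝ] Matrix (Fin N) (Fin N) ℝ) : ℝ :=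
  sSup {r | ∃ s : Fin m → ℝ, ∑ k, s k ^ 2 = 1 ∧ r = frobSq (𝓢 s)}

/-- The set of shift operators `{𝓢 s : s ≥ 0}` parametrized by `𝓢`. -/
def cone {m : ℕ} (𝓢 : (Fin m → ℝ) →ₗ[ℝ] Matrix (Fin N) (Fin N) ℝ) :
    Set (Matrix (Fin N) (Fin N) ℝ) :=
  𝓢 '' {s | ∀ k, 0 ≤ s k}

/-- The vector `z = 𝓢*(V diag(l) Vᵀ - β⁻¹ K)`, with `K = Ĉ + α H`. -/
def zVec {m : ℕ} (𝓢 : (Fin m → ℝ) →ₗ[ℝ] Matrix (Fin N) (Fin N) ℝ)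
    (H V : Matrix (Fin N) (Fin N) ℝ) (l : Fin N → ℝ) : Fin m → ℝ :=
  adj 𝓢 (V * diagonal l * Vᵀ - P.β⁻¹ • (empCov P.X + P.α • H))

/-- The projected-gradient update of Step 1,
`(s - ‖𝓢‖⁻² (𝓢*(𝓢 s) - z))⁺`. -/
def gradStep1 {m : ℕ} (𝓢 : (Fin m → ℝ) →ₗ[ℝ] Matrix (Fin N) (Fin N) ℝ)
    (H V : Matrix (Fin N) (Fin N) ℝ) (l : Fin N → ℝ) (s : Fin m → ℝ) : Fin m → ℝ :=
  fun k => max (s k - 1 / opNormSq 𝓢 * (adj 𝓢 (𝓢 s) k - P.zVec 𝓢 H V l k)) 0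

/-- Sequences generated by the three-block algorithm with the projected-gradient update in
Step 1; `s` is the auxiliary sequence parametrizing the matrices `S`. -/
def IsGradRun {m : ℕ} (𝓢 : (Fin m → ℝ) →ₗ[ℝ] Matrix (Fin N) (Fin N) ℝ)
    (H : Matrix (Fin N) (Fin N) ℝ) (s : ℕ → Fin m → ℝ) (x : ℕ → Point N) : Prop :=
  (∀ i, 0 < (x 0).2.2 i) ∧ ∀ t,
    s (t + 1) = P.gradStep1 𝓢 H (x t).2.1 (x t).2.2 (s t) ∧
    (x (t + 1)).1 = 𝓢 (s (t + 1)) ∧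
    IsStep2 (x (t + 1)).1 (x t).2.2 (x (t + 1)).2.1 ∧
    P.IsStep3 (x (t + 1)).1 (x (t + 1)).2.1 (x t).2.2 (x (t + 1)).2.2

end Data

/-- `x` converges to the set `Y`: the distance from `x t` to `Y` tends to zero, there is a limit
point, and every limit point lies in `Y`. -/
def ConvergesToSet {N : ℕ} (x : ℕ → Point N) (Y : Set (Point N)) : Prop :=
  (∀ ε > 0, ∀ᶠ t in atTop, ∃ y ∈ Y, pointDist (x t) y < ε) ∧
    (∃ y, MapClusterPt y atTop x) ∧
    ∀ y, MapClusterPt y atTop x → y ∈ Y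

end MotifGL

end

namespace MotifGL

open scoped Topology

variable {N M K : ℕ}

/-! The scheme is block descent combined with majorization. Step 1 lowers the objective by at least
`β/4 ‖ΔS‖²`. For orthogonal `V`, the residual `‖S - V diag(l) Vᵀ‖²` depends on `V` only through `-2
tr(Vᵀ S V diag(l))`, so Step 2 cannot raise it. Step 3 minimizes a strongly convex surrogate in
which the concave `c_g` is replaced by its tangent at the previous spectrum. The tangent lies above
`c_g`, so the true objective falls by at least `β/4 ‖Δl‖²` (`objective_descent`).

The objective is coercive on the feasible set (`exists_coercive_bound`): the iterates stay in a
compact set on which the spectrum is positive, and the summable decrease forces `ΔS → 0` and `Δl →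
0`. Nothing similar is known for `V`, nor needed: Step 2 compares `V⁽ᵗ⁺¹⁾` with all orthogonal
matrices for the data `S⁽ᵗ⁺¹⁾`, `l⁽ᵗ⁾`, and the next Step 1 starts from that same `V⁽ᵗ⁺¹⁾`. Passing
to the limit, every limit point is optimal in each block separately.

Blockwise optimality gives stationarity (`mem_stationary_of_blockwise`): the feasible set is a
product, the nonsmooth `ℓ¹` term involves `S` only, and the differential of the smooth part is the
sum of its partial differentials. Neither convexity nor a description of the tangent cone of the
orthogonal group is required. -/

/-! ### Frobenius norm identities for orthogonal conjugation. -/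

theorem frobSq_nonneg (A : Matrix (Fin N) (Fin N) ℝ) : 0 ≤ frobSq A :=
  Finset.sum_nonneg fun _ _ => Finset.sum_nonneg fun _ _ => sq_nonneg _

theorem frobSq_eq_trace (A : Matrix (Fin N) (Fin N) ℝ) : frobSq A = trace (Aᵀ * A) := by
  simp only [frobSq, trace, diag_apply, mul_apply, transpose_apply, sq]
  exact Finset.sum_comm

theorem frobSq_sub (A B : Matrix (Fin N) (Fin N) ℝ) :
    frobSq (A - B) = frobSq A + frobSq B - 2 * trace (Aᵀ * B) := by
  have h : trace (Aᵀ * B) = ∑ i, ∑ j, A i j * B i j := by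
    simp only [trace, diag_apply, mul_apply, transpose_apply]
    exact Finset.sum_comm
  rw [h]
  simp only [frobSq, Finset.mul_sum, ← Finset.sum_add_distrib, ← Finset.sum_sub_distrib,
    Matrix.sub_apply]
  exact Finset.sum_congr rfl fun i _ => Finset.sum_congr rfl fun j _ => by ring

/-- The Frobenius distance to `V diag(l) Vᵀ` for orthogonal `V`. -/
theorem frobSq_sub_conj (S V : Matrix (Fin N) (Fin N) ℝ) (l : Fin N → ℝ) (hV : Vᵀ * V = 1) :
    frobSq (S - V * diagonal l * Vᵀ)
      = frobSq S + ∑ j, l j ^ 2 - 2 * trace (Vᵀ * S * V * diagonal l) := by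
  have h1 : frobSq (V * diagonal l * Vᵀ) = ∑ j, l j ^ 2 := by
    rw [frobSq_eq_trace]
    have : (V * diagonal l * Vᵀ)ᵀ * (V * diagonal l * Vᵀ)
        = V * (diagonal l * (Vᵀ * V) * diagonal l) * Vᵀ := by
      simp only [transpose_mul, transpose_transpose, diagonal_transpose, Matrix.mul_assoc]
    rw [this, trace_mul_comm, ← Matrix.mul_assoc, hV, Matrix.one_mul, Matrix.mul_one,
      diagonal_mul_diagonal, trace_diagonal]
    exact Finset.sum_congr rfl fun j _ => (sq _).symm
  have h2 : trace (Sᵀ * (V * diagonal l * Vᵀ)) = trace (Vᵀ * S * V * diagonal l) := by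
    rw [← trace_transpose]
    simp only [transpose_mul, transpose_transpose, diagonal_transpose]
    rw [Matrix.mul_assoc V, trace_mul_comm, trace_mul_comm _ (diagonal l)]
    simp only [← Matrix.mul_assoc]
  rw [frobSq_sub, h1, h2]

theorem trace_mul_diagonal (A : Matrix (Fin N) (Fin N) ℝ) (l : Fin N → ℝ) :
    trace (A * diagonal l) = ∑ j, A j j * l j := by
  simp [trace, mul_diagonal]

/-- Completing the square in `l` separates a remainder that depends on `S` and `V` only. Hence the
quadratic term of Step 3 is the full residual up to a constant. -/
theorem frobSq_sub_conj' (S V : Matrix (Fin N) (Fin N) ℝ) (l : Fin N → ℝ) (hV : Vᵀ * V = 1) :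
    frobSq (S - V * diagonal l * Vᵀ)
      = frobSq S - ∑ j, (Vᵀ * S * V) j j ^ 2 + ∑ j, (l j - (Vᵀ * S * V) j j) ^ 2 := by
  rw [frobSq_sub_conj S V l hV, trace_mul_diagonal, Finset.mul_sum]
  have : ∑ j, (l j - (Vᵀ * S * V) j j) ^ 2 = ∑ j, l j ^ 2 + ∑ j, (Vᵀ * S * V) j j ^ 2
      - ∑ j, 2 * ((Vᵀ * S * V) j j * l j) := by
    rw [← Finset.sum_add_distrib, ← Finset.sum_sub_distrib]
    exact Finset.sum_congr rfl fun j _ => by ring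
  rw [this]; ring

/-! ### Concavity of the test function and its tangent majorizer. -/

/-- The tangent line of a differentiable concave function lies above its graph. -/
theorem concaveOn_le_tangent {g : ℝ → ℝ} {s : Set ℝ} (hc : ConcaveOn ℝ s g) {a b : ℝ}
    (ha : a ∈ s) (hb : b ∈ s) (hd : DifferentiableAt ℝ g a) :
    g b ≤ g a + deriv g a * (b - a) := by
  rcases lt_trichotomy a b with h | h | h
  · have := hc.slope_le_deriv ha hb h hd
    rw [slope_def_field, div_le_iff₀ (sub_pos.2 h)] at this
    linarith
  · simp [h]
  · have := hc.deriv_le_slope hb ha h hd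
    rw [slope_def_field, le_div_iff₀ (sub_pos.2 h)] at this
    linarith

/-- The derivative of a differentiable concave function is continuous. -/
theorem concaveOn_continuousAt_deriv {g : ℝ → ℝ} {s : Set ℝ} (hs : IsOpen s)
    (hc : ConcaveOn ℝ s g) (hd : ∀ x ∈ s, DifferentiableAt ℝ g x) {a : ℝ} (ha : a ∈ s) :
    ContinuousAt (deriv g) a := by
  have hsl := (hd a ha).hasDerivAt.tendsto_slope
  have hcont := (hd a ha).continuousAt
  have hs' : ∀ᶠ x in 𝓝 a, x ∈ s := hs.mem_nhds ha
  have hslope : ∀ b, b ≠ a → Tendsto (fun x => slope g x b) (𝓝 a) (𝓝 (slope g a b)) := by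
    intro b hb
    simp only [slope_def_field]
    exact (tendsto_const_nhds.sub hcont).div (tendsto_const_nhds.sub tendsto_id)
      (sub_ne_zero.2 hb)
  refine tendsto_order.2 ⟨fun c hca => ?_, fun c hca => ?_⟩
  -- Fix `b > a` whose slope from `a` exceeds `c`. For `x` near `a`, concavity puts `deriv g x`
  -- above `slope g x b`, which is continuous in `x`. The upper bound is the mirror image with `b <
  -- a`.
  · have h1 : ∀ᶠ b in 𝓝[>] a, c < slope g a b :=
      (hsl.mono_left (nhdsGT_le_nhdsNE a)).eventually (lt_mem_nhds hca)
    obtain ⟨b, hb, hbs, hab⟩ := (h1.and ((hs'.filter_mono nhdsWithin_le_nhds).and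
      self_mem_nhdsWithin)).exists
    have hab : a < b := hab
    filter_upwards [(hslope b hab.ne').eventually (lt_mem_nhds hb), hs', gt_mem_nhds hab]
      with x hx hxs hxb
    exact hx.trans_le (hc.slope_le_deriv hxs hbs hxb (hd x hxs))
  · have h1 : ∀ᶠ b in 𝓝[<] a, slope g a b < c :=
      (hsl.mono_left (nhdsLT_le_nhdsNE a)).eventually (gt_mem_nhds hca)
    obtain ⟨b, hb, hbs, hab⟩ := (h1.and ((hs'.filter_mono nhdsWithin_le_nhds).and
      self_mem_nhdsWithin)).exists
    have hab : b < a := hab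
    filter_upwards [(hslope b hab.ne).eventually (gt_mem_nhds hb), hs', lt_mem_nhds hab]
      with x hx hxs hxb
    rw [slope_comm] at hx
    exact (hc.deriv_le_slope hbs hxs hxb (hd x hxs)).trans_lt hx

section Scalar

variable {g : ℝ → ℝ} {n : ℕ}

theorem differentiableAt_of_pos (hd : DifferentiableOn ℝ g (Set.Ioi 0)) {a : ℝ} (ha : 0 < a) :
    DifferentiableAt ℝ g a :=
  hd.differentiableAt (Ioi_mem_nhds ha)

theorem differentiableAt_cg (hd : DifferentiableOn ℝ g (Set.Ioi 0)) {l : Fin n → ℝ}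
    (hl : ∀ i, 0 < l i) : DifferentiableAt ℝ (cg g) l := by
  unfold cg
  refine DifferentiableAt.const_mul (DifferentiableAt.fun_sum fun i _ => ?_) _
  exact (differentiableAt_of_pos hd (hl i)).comp l (differentiableAt_apply i l)

theorem majorizer_eq (hd : DifferentiableOn ℝ g (Set.Ioi 0)) {l₀ : Fin n → ℝ}
    (hl : ∀ i, 0 < l₀ i) (l : Fin n → ℝ) :
    majorizer g l l₀ = (1 / (n : ℝ)) * ∑ i, deriv g (l₀ i) * l i := by
  have h : HasFDerivAt (cg g) ((1 / (n : ℝ)) • ∑ i, deriv g (l₀ i) •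
      (ContinuousLinearMap.proj i : (Fin n → ℝ) →L[ℝ] ℝ)) l₀ := by
    unfold cg
    refine HasFDerivAt.const_mul (HasFDerivAt.fun_sum fun i _ => ?_) _
    exact (differentiableAt_of_pos hd (hl i)).hasDerivAt.comp_hasFDerivAt l₀
      (hasFDerivAt_apply i l₀)
  rw [majorizer, h.fderiv]
  simp

theorem cg_le_majorizer (hc : ConcaveOn ℝ (Set.Ioi 0) g)
    (hd : DifferentiableOn ℝ g (Set.Ioi 0)) {l l₀ : Fin n → ℝ}
    (hl : ∀ i, 0 < l i) (hl₀ : ∀ i, 0 < l₀ i) :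
    cg g l ≤ cg g l₀ + majorizer g l l₀ - majorizer g l₀ l₀ := by
  rw [majorizer_eq hd hl₀, majorizer_eq hd hl₀, cg, cg, ← mul_add, ← mul_sub]
  refine mul_le_mul_of_nonneg_left ?_ (by positivity)
  rw [← Finset.sum_add_distrib, ← Finset.sum_sub_distrib]
  refine Finset.sum_le_sum fun i _ => ?_
  have := concaveOn_le_tangent hc (hl₀ i) (hl i) (differentiableAt_of_pos hd (hl₀ i))
  linarith

/-- The base point of the majorizer moves with the iteration, so its limit requires continuity of
`deriv g`. Concavity supplies this from mere differentiability. -/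
theorem tendsto_majorizer (hc : ConcaveOn ℝ (Set.Ioi 0) g)
    (hd : DifferentiableOn ℝ g (Set.Ioi 0)) {ι : Type*} {F : Filter ι}
    {u u₀ : ι → Fin n → ℝ} {l l₀ : Fin n → ℝ} (hl₀ : ∀ i, 0 < l₀ i)
    (hu₀ : Tendsto u₀ F (𝓝 l₀)) (hu : Tendsto u F (𝓝 l)) :
    Tendsto (fun t => majorizer g (u t) (u₀ t)) F (𝓝 (majorizer g l l₀)) := by
  have hu₀' := tendsto_pi_nhds.1 hu₀
  have hu' := tendsto_pi_nhds.1 hu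
  have hpos : ∀ᶠ t in F, ∀ i, 0 < u₀ t i :=
    eventually_all.2 fun i => (hu₀' i).eventually (lt_mem_nhds (hl₀ i))
  rw [majorizer_eq hd hl₀]
  refine Tendsto.congr' (hpos.mono fun t ht => (majorizer_eq hd ht (u t)).symm) ?_
  refine Tendsto.const_mul _ (tendsto_finsetSum _ fun i _ => Tendsto.mul ?_ (hu' i))
  exact (concaveOn_continuousAt_deriv isOpen_Ioi hc
    (fun x hx => differentiableAt_of_pos hd hx) (hl₀ i)).tendsto.comp (hu₀' i)

theorem cg_concaveOn (hc : ConcaveOn ℝ (Set.Ioi 0) g) :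
    ConcaveOn ℝ {l : Fin n → ℝ | ∀ i, 0 < l i} (cg g) := by
  refine ⟨fun x hx y hy a b ha hb hab i => hc.1 (hx i) (hy i) ha hb hab,
    fun x hx y hy a b ha hb hab => ?_⟩
  simp only [cg, smul_eq_mul]
  rw [mul_left_comm, mul_left_comm b, ← mul_add]
  refine mul_le_mul_of_nonneg_left ?_ (by positivity)
  rw [Finset.mul_sum, Finset.mul_sum, ← Finset.sum_add_distrib]
  exact Finset.sum_le_sum fun i _ => hc.2 (hx i) (hy i) ha hb hab

end Scalar

theorem Data.convex_spectra (P : Data N M K) (hc : ConcaveOn ℝ (Set.Ioi 0) P.g) :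
    Convex ℝ (P.spectra) :=
  (cg_concaveOn hc).convex_ge _

/-! ### Strong convexity of the block problems and descent of the objective. -/

/-- Quadratic growth at the minimizer of a convex function plus a quadratic. -/
theorem quadratic_growth_of_isMinOn {E : Type*} [AddCommGroup E] [Module ℝ E] {C : Set E}
    {ψ q : E → ℝ} {β D : ℝ} {x y : E} (hβ : 0 < β) (hψ : ConvexOn ℝ C ψ) (hx : x ∈ C) (hy : y ∈ C)
    (hq : q ((1 / 2 : ℝ) • x + (1 / 2 : ℝ) • y) ≤ 1 / 2 * q x + 1 / 2 * q y - 1 / 4 * D)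
    (hmin : IsMinOn (fun z => ψ z + β / 2 * q z) C x) :
    ψ x + β / 2 * q x + β / 4 * D ≤ ψ y + β / 2 * q y := by
  -- The minimizer is compared with the midpoint of `x` and `y`. The midpoint gain `β/8 * D`,
  -- doubled on clearing the factor `1/2`, gives the constant `β/4`.
  have h1 := hψ.2 hx hy (by norm_num : (0 : ℝ) ≤ 1 / 2) (by norm_num : (0 : ℝ) ≤ 1 / 2)
    (by norm_num)
  have h2 := isMinOn_iff.1 hmin _ (hψ.1 hx hy (by norm_num : (0 : ℝ) ≤ 1 / 2)
    (by norm_num : (0 : ℝ) ≤ 1 / 2) (by norm_num))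
  have h3 := mul_le_mul_of_nonneg_left hq (by positivity : 0 ≤ β / 2)
  simp only [smul_eq_mul] at h1
  linarith

theorem convexOn_l1Norm (C : Set (Matrix (Fin N) (Fin N) ℝ)) (hC : Convex ℝ C) :
    ConvexOn ℝ C l1Norm := by
  refine ⟨hC, fun x _ y _ a b ha hb _ => ?_⟩
  simp only [l1Norm, smul_eq_mul, Finset.mul_sum, ← Finset.sum_add_distrib]
  refine Finset.sum_le_sum fun i _ => Finset.sum_le_sum fun j _ => ?_
  simp only [Matrix.add_apply, Matrix.smul_apply, smul_eq_mul]
  exact (abs_add_le _ _).trans (by rw [abs_mul, abs_mul, abs_of_nonneg ha, abs_of_nonneg hb])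

theorem convexOn_neg_sum_log :
    ConvexOn ℝ {l : Fin N → ℝ | ∀ i, 0 < l i} (fun l => -∑ j, Real.log (l j)) := by
  refine ⟨fun x hx y hy a b ha hb hab i => convex_Ioi (0 : ℝ) (hx i) (hy i) ha hb hab,
    fun x hx y hy a b ha hb hab => ?_⟩
  simp only [smul_eq_mul, mul_neg, ← neg_add, Finset.mul_sum, ← Finset.sum_add_distrib]
  refine neg_le_neg (Finset.sum_le_sum fun i _ => ?_)
  exact strictConcaveOn_log_Ioi.concaveOn.2 (hx i) (hy i) ha hb hab

theorem log_det_diagonal {l : Fin N → ℝ} (hl : ∀ i, 0 < l i) :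
    Real.log (det (diagonal l)) = ∑ j, Real.log (l j) := by
  rw [det_diagonal, Real.log_prod fun i _ => (hl i).ne']

namespace Data

variable (P : Data N M K)

theorem exactStep1_growth (hα : 0 < P.α) (hβ : 0 < P.β) {𝒮 : Set (Matrix (Fin N) (Fin N) ℝ)}
    (hC : Convex ℝ 𝒮) {x : Point N} {S S' : Matrix (Fin N) (Fin N) ℝ}
    (hS' : P.IsExactStep1 𝒮 x S') (hS : S ∈ 𝒮) :
    P.step1Obj x.2.1 x.2.2 S' + P.β / 4 * frobSq (S' - S) ≤ P.step1Obj x.2.1 x.2.2 S := by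
  have hψ : ConvexOn ℝ 𝒮 (fun S => trace (empCov P.X * S) + P.α * l1Norm S) := by
    have hlin : ConvexOn ℝ 𝒮 (fun S => trace (empCov P.X * S)) :=
      ⟨hC, fun x _ y _ a b _ _ _ => by simp [Matrix.mul_add, trace_add]⟩
    exact hlin.add ((convexOn_l1Norm 𝒮 hC).smul hα.le)
  have hq : frobSq ((1 / 2 : ℝ) • S' + (1 / 2 : ℝ) • S - x.2.1 * diagonal x.2.2 * x.2.1ᵀ)
      = 1 / 2 * frobSq (S' - x.2.1 * diagonal x.2.2 * x.2.1ᵀ)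
        + 1 / 2 * frobSq (S - x.2.1 * diagonal x.2.2 * x.2.1ᵀ) - 1 / 4 * frobSq (S' - S) := by
    generalize x.2.1 * diagonal x.2.2 * x.2.1ᵀ = B
    simp only [frobSq, Finset.mul_sum, ← Finset.sum_add_distrib, ← Finset.sum_sub_distrib]
    refine Finset.sum_congr rfl fun i _ => Finset.sum_congr rfl fun j _ => ?_
    simp only [Matrix.add_apply, Matrix.sub_apply, Matrix.smul_apply, smul_eq_mul]
    ring
  exact quadratic_growth_of_isMinOn (ψ := fun S => trace (empCov P.X * S) + P.α * l1Norm S)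
    (q := fun S => frobSq (S - x.2.1 * diagonal x.2.2 * x.2.1ᵀ)) (D := frobSq (S' - S))
    hβ hψ hS'.1 hS hq.le hS'.2

/-- The majorizer is linear in `l`, so only `-log` and the quadratic matter for convexity of the
surrogate. The constraint set is convex as a superlevel set of the concave `c_g`. -/
theorem step3_growth (hβ : 0 < P.β) (hc : ConcaveOn ℝ (Set.Ioi 0) P.g)
    {S V : Matrix (Fin N) (Fin N) ℝ} {l₀ l l' : Fin N → ℝ}
    (hl' : P.IsStep3 S V l₀ l') (hl : l ∈ P.spectra) :
    P.step3Obj S V l₀ l' + P.β / 4 * ∑ j, (l' j - l j) ^ 2 ≤ P.step3Obj S V l₀ l := by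
  have hψ : ConvexOn ℝ P.spectra
      (fun l => -∑ j, Real.log (l j) + P.γ * majorizer P.g l l₀) := by
    refine ConvexOn.add (convexOn_neg_sum_log.subset (fun l hl => hl.1) (P.convex_spectra hc))
      ⟨P.convex_spectra hc, fun x _ y _ a b _ _ _ => ?_⟩
    simp only [majorizer, map_add, map_smul, smul_eq_mul]
    exact le_of_eq (by ring)
  have := quadratic_growth_of_isMinOn (x := l') (y := l) (D := ∑ j, (l' j - l j) ^ 2)
    (q := fun l => ∑ j, (l j - (Vᵀ * S * V) j j) ^ 2) hβ hψ hl'.1 hl (le_of_eq ?_) ?_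
  · simp only [step3Obj]; linarith
  · simp only [Finset.mul_sum, ← Finset.sum_add_distrib, ← Finset.sum_sub_distrib]
    refine Finset.sum_congr rfl fun i _ => ?_
    simp only [Pi.add_apply, Pi.smul_apply, smul_eq_mul]
    ring
  · convert hl'.2 using 2 with l
    simp only [step3Obj]; ring

theorem objective_eq_step1Obj {x : Point N} (hl : ∀ i, 0 < x.2.2 i) :
    P.objective x = P.step1Obj x.2.1 x.2.2 x.1 - ∑ j, Real.log (x.2.2 j)
      + P.γ * cg P.g x.2.2 := by
  simp only [objective, step1Obj, log_det_diagonal hl]; ring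

/-- `Step 2` does not increase the objective of `Step 1`. -/
theorem step1Obj_le_of_isStep2 (hβ : 0 < P.β) {S V V' : Matrix (Fin N) (Fin N) ℝ} {l : Fin N → ℝ}
    (hV : Vᵀ * V = 1) (hV' : IsStep2 S l V') : P.step1Obj V' l S ≤ P.step1Obj V l S := by
  have h := isMaxOn_iff.1 hV'.2 V hV
  have h' := hV'.1
  simp only [Set.mem_ofPred_eq] at h'
  simp only [step1Obj, frobSq_sub_conj S V l hV, frobSq_sub_conj S V' l h']
  have : P.β / 2 * (frobSq S + ∑ j, l j ^ 2 - 2 * trace (V'ᵀ * S * V' * diagonal l))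
      ≤ P.β / 2 * (frobSq S + ∑ j, l j ^ 2 - 2 * trace (Vᵀ * S * V * diagonal l)) :=
    mul_le_mul_of_nonneg_left (by linarith) (by positivity)
  linarith

/-- The subtracted bracket does not involve `l`, so Step 3 minimizes the objective in `l` with `c_g`
replaced by its majorizer. -/
theorem step3Obj_eq {S V : Matrix (Fin N) (Fin N) ℝ} (hV : Vᵀ * V = 1) (l₀ l : Fin N → ℝ) :
    P.step3Obj S V l₀ l = P.step1Obj V l S - ∑ j, Real.log (l j) + P.γ * majorizer P.g l l₀
      - (trace (empCov P.X * S) + P.α * l1Norm S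
        + P.β / 2 * (frobSq S - ∑ j, (Vᵀ * S * V) j j ^ 2)) := by
  simp only [step1Obj, step3Obj, frobSq_sub_conj' S V l hV]; ring

/-- One sweep of the three block updates decreases the objective. -/
theorem objective_descent (hβ : 0 < P.β) (hγ : 0 ≤ P.γ) (hc : ConcaveOn ℝ (Set.Ioi 0) P.g)
    (hd : DifferentiableOn ℝ P.g (Set.Ioi 0)) {𝒮 : Set (Matrix (Fin N) (Fin N) ℝ)}
    {x y : Point N} (hx : x ∈ P.feasible 𝒮)
    (h1 : P.step1Obj x.2.1 x.2.2 y.1 + P.β / 4 * frobSq (y.1 - x.1)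
      ≤ P.step1Obj x.2.1 x.2.2 x.1)
    (h2 : IsStep2 y.1 x.2.2 y.2.1) (h3 : P.IsStep3 y.1 y.2.1 x.2.2 y.2.2) :
    P.objective y + P.β / 4 * (frobSq (y.1 - x.1) + ∑ j, (y.2.2 j - x.2.2 j) ^ 2)
      ≤ P.objective x := by
  have e2 := P.step1Obj_le_of_isStep2 hβ hx.2.1 h2
  have e3 := P.step3_growth hβ hc h3 hx.2.2
  have hV : y.2.1ᵀ * y.2.1 = 1 := h2.1
  rw [P.step3Obj_eq hV, P.step3Obj_eq hV] at e3
  have e4 := mul_le_mul_of_nonneg_left (cg_le_majorizer hc hd h3.1.1 hx.2.2.1) hγ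
  rw [P.objective_eq_step1Obj hx.2.2.1, P.objective_eq_step1Obj h3.1.1]
  linarith

end Data

/-! ### Coercivity and compact sublevel sets. -/

theorem abs_apply_le_one_of_orthogonal {V : Matrix (Fin N) (Fin N) ℝ} (hV : Vᵀ * V = 1)
    (i j : Fin N) : |V i j| ≤ 1 := by
  have h : ∑ k, V k j * V k j = 1 := by
    have := congrFun (congrFun hV j) j
    simpa [mul_apply] using this
  have h2 : V i j * V i j ≤ ∑ k, V k j * V k j :=
    Finset.single_le_sum (f := fun k => V k j * V k j) (fun k _ => mul_self_nonneg _)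
      (Finset.mem_univ i)
  exact abs_le_one_iff_mul_self_le_one.2 (h2.trans_eq h)

theorem abs_apply_le_l1Norm (S : Matrix (Fin N) (Fin N) ℝ) (i j : Fin N) : |S i j| ≤ l1Norm S :=
  (Finset.single_le_sum (f := fun j => |S i j|) (fun _ _ => abs_nonneg _)
    (Finset.mem_univ j)).trans
  (Finset.single_le_sum (f := fun i => ∑ j, |S i j|)
    (fun _ _ => Finset.sum_nonneg fun _ _ => abs_nonneg _) (Finset.mem_univ i))

theorem l1Norm_nonneg (S : Matrix (Fin N) (Fin N) ℝ) : 0 ≤ l1Norm S :=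
  Finset.sum_nonneg fun _ _ => Finset.sum_nonneg fun _ _ => abs_nonneg _

theorem conj_diag_le_l1Norm {V : Matrix (Fin N) (Fin N) ℝ} (hV : Vᵀ * V = 1)
    (S : Matrix (Fin N) (Fin N) ℝ) (k : Fin N) : (Vᵀ * S * V) k k ≤ l1Norm S := by
  have h : (Vᵀ * S * V) k k = ∑ i, ∑ j, V i k * S i j * V j k := by
    simp only [mul_apply, transpose_apply, Finset.sum_mul]
    exact Finset.sum_comm
  rw [h]
  refine Finset.sum_le_sum fun i _ => Finset.sum_le_sum fun j _ => ?_
  refine (le_abs_self _).trans ?_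
  rw [abs_mul, abs_mul]
  calc |V i k| * |S i j| * |V j k| ≤ 1 * |S i j| * 1 := by
        gcongr
        · exact abs_apply_le_one_of_orthogonal hV i k
        · exact abs_apply_le_one_of_orthogonal hV j k
    _ = |S i j| := by ring

theorem trace_empCov_mul_nonneg (X : Matrix (Fin N) (Fin M) ℝ) {B : Matrix (Fin N) (Fin N) ℝ}
    (hB : B.PosSemidef) : 0 ≤ trace (empCov X * B) := by
  rw [empCov, Matrix.smul_mul, trace_smul, Matrix.sum_mul, trace_sum]
  refine mul_nonneg (by positivity) (Finset.sum_nonneg fun m _ => ?_)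
  have := hB.dotProduct_mulVec_nonneg (fun i => X i m)
  rw [trace_mul_comm, mul_vecMulVec, trace_vecMulVec, dotProduct_comm]
  simpa using this

theorem posSemidef_conj_diagonal (V : Matrix (Fin N) (Fin N) ℝ) {l : Fin N → ℝ}
    (hl : ∀ i, 0 < l i) : (V * diagonal l * Vᵀ).PosSemidef := by
  have := (PosSemidef.diagonal (fun i => (hl i).le) : (diagonal l).PosSemidef)
  simpa using this.mul_mul_conjTranspose_same V

theorem neg_le_trace_mul {β : ℝ} (hβ : 0 < β) (C R : Matrix (Fin N) (Fin N) ℝ) :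
    -(β / 8 * frobSq R + 2 / β * frobSq C) ≤ trace (C * R) := by
  have h : frobSq R = ∑ i, ∑ j, R j i ^ 2 := Finset.sum_comm
  rw [h, frobSq]
  simp only [trace, diag_apply, mul_apply, Finset.mul_sum, ← Finset.sum_add_distrib,
    ← Finset.sum_neg_distrib]
  refine Finset.sum_le_sum fun i _ => Finset.sum_le_sum fun j _ => ?_
  have : β / 8 * R j i ^ 2 + 2 / β * C i j ^ 2 + C i j * R j i
      = β / 8 * (R j i + 4 / β * C i j) ^ 2 := by field_simp; ring
  have h2 : 0 ≤ β / 8 * (R j i + 4 / β * C i j) ^ 2 := by positivity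
  linarith

theorem one_add_log_le {a u : ℝ} (ha : 0 < a) (hu : 0 < u) :
    1 + Real.log a ≤ a * u - Real.log u := by
  have := Real.log_le_sub_one_of_pos (mul_pos ha hu)
  rw [Real.log_mul ha.ne' hu.ne'] at this
  linarith

namespace Data

variable (P : Data N M K)

/-- The penalty `β/2 ‖R‖²` on the residual `R` is split: `β/8` absorbs `tr(Ĉ R)`, `β/8` ties `l` to
the diagonal of `Vᵀ S V`, and the rest is discarded. That diagonal is bounded by `‖S‖₁`, so half of
the `ℓ¹` term pays for linear growth in `l`. The remaining `tr(Ĉ V diag(l) Vᵀ)` is nonnegative, and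
the similarity constraint bounds `c_g` from below. -/
theorem exists_coercive_bound (hα : 0 < P.α) (hβ : 0 < P.β) (hγ : 0 ≤ P.γ) :
    ∃ a > 0, ∃ C : ℝ, ∀ 𝒮 : Set (Matrix (Fin N) (Fin N) ℝ), ∀ x ∈ P.feasible 𝒮,
      P.α / 2 * l1Norm x.1 + ∑ k, (a * x.2.2 k - Real.log (x.2.2 k)) ≤ P.objective x + C := by
  -- Chosen so that `N * a ≤ α / 2`; the `N + 1` avoids division by zero when `N = 0`.
  set a : ℝ := P.α / (2 * (N + 1)) with ha_def
  have ha : 0 < a := by positivity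
  refine ⟨a, ha, 2 / P.β * frobSq (empCov P.X) + ∑ _k : Fin N, 2 * a ^ 2 / P.β
    - P.γ * (cg P.g P.lref - P.δ), ?_⟩
  rintro 𝒮 ⟨S, V, l⟩ ⟨-, hV, hl, hcg⟩
  simp only at hV hl hcg ⊢
  set R := S - V * diagonal l * Vᵀ with hR
  have htr : trace (empCov P.X * S) =
      trace (empCov P.X * (V * diagonal l * Vᵀ)) + trace (empCov P.X * R) := by
    rw [← trace_add, ← Matrix.mul_add, hR]; congr 2; abel
  have h1 := trace_empCov_mul_nonneg P.X (posSemidef_conj_diagonal V hl)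
  have h2 := neg_le_trace_mul hβ (empCov P.X) R
  have h3 : P.γ * (cg P.g P.lref - P.δ) ≤ P.γ * cg P.g l := mul_le_mul_of_nonneg_left hcg hγ
  -- The difference of the two sides is the squared distance from `S` to `V diag(w) Vᵀ`, where `w`
  -- is the diagonal of `Vᵀ S V`.
  have h4 : ∑ j, (l j - (Vᵀ * S * V) j j) ^ 2 ≤ frobSq R := by
    have e := frobSq_sub_conj' S V l hV
    have e' := frobSq_sub_conj' S V (fun j => (Vᵀ * S * V) j j) hV
    have e'' := frobSq_nonneg (S - V * diagonal (fun j => (Vᵀ * S * V) j j) * Vᵀ)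
    simp only [sub_self, ne_eq, OfNat.ofNat_ne_zero, not_false_eq_true, zero_pow,
      Finset.sum_const_zero, add_zero] at e'
    linarith
  have h5 : ∑ k, a * l k - P.β / 8 * ∑ j, (l j - (Vᵀ * S * V) j j) ^ 2
      - ∑ _k : Fin N, 2 * a ^ 2 / P.β ≤ P.α / 2 * l1Norm S := by
    have hsum : ∑ _k : Fin N, a * l1Norm S ≤ P.α / 2 * l1Norm S := by
      rw [Finset.sum_const, Finset.card_univ, Fintype.card_fin, nsmul_eq_mul, ← mul_assoc]
      refine mul_le_mul_of_nonneg_right ?_ (l1Norm_nonneg S)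
      rw [ha_def, mul_div_assoc', div_le_div_iff₀ (by positivity) (by positivity)]
      nlinarith
    refine le_trans ?_ hsum
    rw [Finset.mul_sum, ← Finset.sum_sub_distrib, ← Finset.sum_sub_distrib]
    refine Finset.sum_le_sum fun k _ => ?_
    have hk := mul_le_mul_of_nonneg_left (conj_diag_le_l1Norm hV S k) ha.le
    set w := (Vᵀ * S * V) k k
    have e : P.β / 8 * (l k - w) ^ 2 + 2 * a ^ 2 / P.β - a * (l k - w)
        = P.β / 8 * (l k - w - 4 * a / P.β) ^ 2 := by field_simp; ring
    have e2 : 0 ≤ P.β / 8 * (l k - w - 4 * a / P.β) ^ 2 := by positivity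
    linarith
  have h6 : P.β / 8 * ∑ j, (l j - (Vᵀ * S * V) j j) ^ 2 ≤ P.β / 8 * frobSq R :=
    mul_le_mul_of_nonneg_left h4 (by positivity)
  have h7 : 0 ≤ P.β / 4 * frobSq R := mul_nonneg (by positivity) (frobSq_nonneg R)
  rw [P.objective_eq_step1Obj (x := (S, V, l)) hl, Finset.sum_sub_distrib]
  simp only [step1Obj, ← hR, htr]
  linarith

theorem exists_objective_lower_bound (hα : 0 < P.α) (hβ : 0 < P.β) (hγ : 0 ≤ P.γ) :
    ∃ b : ℝ, ∀ 𝒮 : Set (Matrix (Fin N) (Fin N) ℝ), ∀ x ∈ P.feasible 𝒮, b ≤ P.objective x := by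
  obtain ⟨a, ha, C, h⟩ := P.exists_coercive_bound hα hβ hγ
  refine ⟨∑ _k : Fin N, (1 + Real.log a) - C, fun 𝒮 x hx => ?_⟩
  have h1 := h 𝒮 x hx
  have h2 : ∑ _k : Fin N, (1 + Real.log a) ≤ ∑ k, (a * x.2.2 k - Real.log (x.2.2 k)) :=
    Finset.sum_le_sum fun k _ => one_add_log_le ha (hx.2.2.1 k)
  have h3 := mul_nonneg (half_pos hα).le (l1Norm_nonneg x.1)
  linarith

/-- Sublevel sets of the objective are contained in compact sets on which the spectrum is
positive. -/
theorem exists_compact_sublevel (hα : 0 < P.α) (hβ : 0 < P.β) (hγ : 0 ≤ P.γ) (B : ℝ) :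
    ∃ Q : Set (Point N), IsCompact Q ∧ (∀ x ∈ Q, ∀ i, 0 < x.2.2 i) ∧
      ∀ 𝒮 : Set (Matrix (Fin N) (Fin N) ℝ), ∀ x ∈ P.feasible 𝒮, P.objective x ≤ B → x ∈ Q := by
  obtain ⟨a, ha, C, h⟩ := P.exists_coercive_bound hα hβ hγ
  set m := 1 + Real.log a with hm
  set D := B + C - ∑ _k : Fin N, m with hD
  let QS : Set (Matrix (Fin N) (Fin N) ℝ) :=
    Set.univ.pi fun _ => Set.univ.pi fun _ => Set.Icc (-(2 * D / P.α)) (2 * D / P.α)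
  let QV : Set (Matrix (Fin N) (Fin N) ℝ) :=
    Set.univ.pi fun _ => Set.univ.pi fun _ => Set.Icc (-1) 1
  -- Each term `a u - log u` is at least `m` and, in the sublevel set, at most `D + m`. Dropping `a
  -- u > 0` gives the lower endpoint; bounding `(a/2) u - log u` below by `1 + log (a/2)` gives the
  -- upper one.
  let Ql : Set (Fin N → ℝ) :=
    Set.univ.pi fun _ => Set.Icc (Real.exp (-(D + m)))
      (2 * (D + m - (1 + Real.log (a / 2))) / a)
  have hQS : IsCompact QS := isCompact_univ_pi fun _ => isCompact_univ_pi fun _ => isCompact_Icc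
  have hQV : IsCompact QV := isCompact_univ_pi fun _ => isCompact_univ_pi fun _ => isCompact_Icc
  have hQl : IsCompact Ql := isCompact_univ_pi fun _ => isCompact_Icc
  refine ⟨QS ×ˢ QV ×ˢ Ql, hQS.prod (hQV.prod hQl), ?_, ?_⟩
  · rintro x ⟨-, -, hx⟩ i
    exact (Real.exp_pos _).trans_le (hx i trivial).1
  · intro 𝒮 x hx hxB
    have h1 := h 𝒮 x hx
    have hl := hx.2.2.1
    have hterm : ∀ k, 0 ≤ a * x.2.2 k - Real.log (x.2.2 k) - m := fun k =>
      sub_nonneg.2 (one_add_log_le ha (hl k))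
    have hsum : ∑ k, (a * x.2.2 k - Real.log (x.2.2 k) - m)
        = ∑ k, (a * x.2.2 k - Real.log (x.2.2 k)) - ∑ _k : Fin N, m := Finset.sum_sub_distrib ..
    have hnn := Finset.sum_nonneg fun k (_ : k ∈ Finset.univ) => hterm k
    have h3 := mul_nonneg (half_pos hα).le (l1Norm_nonneg x.1)
    have hl1 : l1Norm x.1 ≤ 2 * D / P.α := by
      rw [le_div_iff₀ hα]; linarith
    have hk : ∀ k, a * x.2.2 k - Real.log (x.2.2 k) ≤ D + m := fun k => by
      have := Finset.single_le_sum (fun k _ => hterm k) (Finset.mem_univ k)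
      linarith
    refine ⟨fun i _ j _ => abs_le.1 ((abs_apply_le_l1Norm x.1 i j).trans hl1),
      fun i _ j _ => abs_le.1 (abs_apply_le_one_of_orthogonal hx.2.1 i j), fun k _ => ⟨?_, ?_⟩⟩
    · rw [← Real.le_log_iff_exp_le (hl k)]
      have := mul_pos ha (hl k)
      linarith [hk k]
    · rw [le_div_iff₀ ha]
      have := one_add_log_le (half_pos ha) (hl k)
      linarith [hk k]

end Data

/-! ### Directional derivatives, and stationarity from blockwise optimality. -/

/-- At a given point, a function of three blocks has the same derivative as the sum of its partial
functions. -/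
theorem hasFDerivAt_sum_partial {E₁ E₂ E₃ : Type*} [NormedAddCommGroup E₁] [NormedSpace ℝ E₁]
    [NormedAddCommGroup E₂] [NormedSpace ℝ E₂] [NormedAddCommGroup E₃] [NormedSpace ℝ E₃]
    {Q : E₁ × E₂ × E₃ → ℝ} {x : E₁ × E₂ × E₃} (hQ : DifferentiableAt ℝ Q x) :
    HasFDerivAt (fun y : E₁ × E₂ × E₃ =>
      Q (y.1, x.2.1, x.2.2) + Q (x.1, y.2.1, x.2.2) + Q (x.1, x.2.1, y.2.2)) (fderiv ℝ Q x) x := by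
  have hQ' := hQ.hasFDerivAt
  have p1 : HasFDerivAt (fun y : E₁ × E₂ × E₃ => y.1) (ContinuousLinearMap.fst ℝ E₁ (E₂ × E₃)) x :=
    hasFDerivAt_fst
  have p2 : HasFDerivAt (fun y : E₁ × E₂ × E₃ => y.2) (ContinuousLinearMap.snd ℝ E₁ (E₂ × E₃)) x :=
    hasFDerivAt_snd
  have h1 := hQ'.comp (f := fun y : E₁ × E₂ × E₃ => (y.1, x.2.1, x.2.2)) x
    (p1.prodMk (hasFDerivAt_const (x.2.1, x.2.2) x))
  have h2 := hQ'.comp (f := fun y : E₁ × E₂ × E₃ => (x.1, y.2.1, x.2.2)) x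
    ((hasFDerivAt_const x.1 x).prodMk (p2.fst.prodMk (hasFDerivAt_const x.2.2 x)))
  have h3 := hQ'.comp (f := fun y : E₁ × E₂ × E₃ => (x.1, x.2.1, y.2.2)) x
    ((hasFDerivAt_const x.1 x).prodMk ((hasFDerivAt_const x.2.1 x).prodMk p2.snd))
  refine ((h1.add h2).add h3).congr_fderiv ?_
  refine ContinuousLinearMap.ext fun d => ?_
  change fderiv ℝ Q x (d.1, 0) + fderiv ℝ Q x (0, d.2.1, 0) + fderiv ℝ Q x (0, 0, d.2.2)
    = fderiv ℝ Q x d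
  rw [← map_add, ← map_add]
  congr 1
  ext <;> simp

/-- One-sided directional derivative of the absolute value at `a` in the direction `b`. -/
noncomputable def absDir (a b : ℝ) : ℝ := if a = 0 then |b| else SignType.sign a * b

/-- Away from `a = 0` the sign is eventually constant; at `a = 0` the factor `c n ≥ 0` moves inside
the absolute value. General scales `c` and increments `e` cover both tangent-cone sequences and
difference quotients. -/
theorem tendsto_smul_abs_sub {ι : Type*} {F : Filter ι} {c e : ι → ℝ} {a b : ℝ}
    (hc : ∀ n, 0 ≤ c n) (he : Tendsto e F (𝓝 0)) (hce : Tendsto (fun n => c n * e n) F (𝓝 b)) :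
    Tendsto (fun n => c n * (|a + e n| - |a|)) F (𝓝 (absDir a b)) := by
  have hae : Tendsto (fun n => a + e n) F (𝓝 a) := by simpa using he.const_add a
  rcases lt_trichotomy a 0 with ha | rfl | ha
  · have : absDir a b = -b := by simp [absDir, ha.ne, sign_neg ha]
    rw [this]
    refine hce.neg.congr' ?_
    filter_upwards [hae.eventually (gt_mem_nhds ha)] with n hn
    rw [abs_of_neg hn, abs_of_neg ha]; ring
  · have : absDir 0 b = |b| := by simp [absDir]
    rw [this]
    refine hce.abs.congr fun n => ?_
    simp [abs_mul, abs_of_nonneg (hc n)]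
  · have : absDir a b = b := by simp [absDir, ha.ne', sign_pos ha]
    rw [this]
    refine hce.congr' ?_
    filter_upwards [hae.eventually (lt_mem_nhds ha)] with n hn
    rw [abs_of_pos hn, abs_of_pos ha]; ring

/-- One-sided directional derivative of the entrywise `ℓ¹` norm. -/
noncomputable def l1Dir (A B : Matrix (Fin N) (Fin N) ℝ) : ℝ := ∑ i, ∑ j, absDir (A i j) (B i j)

theorem tendsto_smul_l1Norm_sub {ι : Type*} {F : Filter ι} {c : ι → ℝ}
    {E : ι → Matrix (Fin N) (Fin N) ℝ} {A B : Matrix (Fin N) (Fin N) ℝ}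
    (hc : ∀ n, 0 ≤ c n) (he : Tendsto E F (𝓝 0)) (hce : Tendsto (fun n => c n • E n) F (𝓝 B)) :
    Tendsto (fun n => c n * (l1Norm (A + E n) - l1Norm A)) F (𝓝 (l1Dir A B)) := by
  simp only [l1Norm, ← Finset.sum_sub_distrib, Finset.mul_sum, l1Dir]
  refine tendsto_finsetSum _ fun i _ => tendsto_finsetSum _ fun j _ => ?_
  exact tendsto_smul_abs_sub hc (tendsto_pi_nhds.1 (tendsto_pi_nhds.1 he i) j)
    (tendsto_pi_nhds.1 (tendsto_pi_nhds.1 hce i) j)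

theorem hasDerivWithinAt_l1Norm (A B : Matrix (Fin N) (Fin N) ℝ) :
    HasDerivWithinAt (fun h : ℝ => l1Norm (A + h • B)) (l1Dir A B) (Set.Ici 0) 0 := by
  rw [hasDerivWithinAt_iff_tendsto_slope, Set.Ici_sdiff_left]
  have h0 : Tendsto (fun h : ℝ => h • B) (𝓝[>] 0) (𝓝 0) := by
    have : Continuous fun h : ℝ => h • B := continuous_id.smul continuous_const
    simpa using (this.tendsto 0).mono_left nhdsWithin_le_nhds
  have h1 : Tendsto (fun h : ℝ => |h⁻¹| • (h • B)) (𝓝[>] 0) (𝓝 B) := by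
    refine tendsto_const_nhds.congr' ?_
    filter_upwards [self_mem_nhdsWithin] with h hh
    have hh : 0 < h := hh
    rw [abs_of_pos (inv_pos.2 hh), smul_smul, inv_mul_cancel₀ hh.ne', one_smul]
  refine (tendsto_smul_l1Norm_sub (A := A) (fun h => abs_nonneg h⁻¹) h0 h1).congr' ?_
  filter_upwards [self_mem_nhdsWithin] with h hh
  have hh : 0 < h := hh
  simp [slope_def_field, abs_of_pos hh, div_eq_inv_mul]

section Stationarity

attribute [local instance] Matrix.normedAddCommGroup Matrix.normedSpace

/-- The part of the objective that is differentiable, without the test function. -/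
noncomputable def Data.smoothPart (P : Data N M K) (x : Point N) : ℝ :=
  trace (empCov P.X * x.1) - Real.log (det (diagonal x.2.2))
    + P.β / 2 * frobSq (x.1 - x.2.1 * diagonal x.2.2 * x.2.1ᵀ)

theorem Data.differentiableAt_smoothPart (P : Data N M K) {x : Point N}
    (hl : ∀ i, 0 < x.2.2 i) : DifferentiableAt ℝ P.smoothPart x := by
  have d1 : ∀ i j, DifferentiableAt ℝ (fun y : Point N => y.1 i j) x := fun i j =>
    differentiableAt_pi.1 (differentiableAt_pi.1 (differentiableAt_fst (p := x)) i) j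
  have d2 : ∀ i j, DifferentiableAt ℝ (fun y : Point N => y.2.1 i j) x := fun i j =>
    differentiableAt_pi.1 (differentiableAt_pi.1 (differentiableAt_snd (p := x)).fst i) j
  have d3 : ∀ i, DifferentiableAt ℝ (fun y : Point N => y.2.2 i) x := fun i =>
    differentiableAt_pi.1 (differentiableAt_snd (p := x)).snd i
  have e : P.smoothPart = fun y : Point N => ∑ i, ∑ j, empCov P.X i j * y.1 j i
      - Real.log (∏ i, y.2.2 i)
      + P.β / 2 * ∑ i, ∑ j, (y.1 i j - ∑ k, y.2.1 i k * y.2.2 k * y.2.1 j k) ^ 2 := by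
    funext y
    have hr : ∀ i j, (y.2.1 * diagonal y.2.2 * y.2.1ᵀ) i j
        = ∑ k, y.2.1 i k * y.2.2 k * y.2.1 j k := fun i j => by
      rw [mul_apply]; simp only [mul_diagonal, transpose_apply]
    simp only [smoothPart, det_diagonal, frobSq, Matrix.sub_apply, hr]
    simp only [trace, diag_apply, mul_apply]
  rw [e]
  refine DifferentiableAt.add (DifferentiableAt.sub ?_ ?_) (DifferentiableAt.const_mul ?_ _)
  · exact DifferentiableAt.fun_sum fun i _ => DifferentiableAt.fun_sum fun j _ =>
      (d1 j i).const_mul _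
  · refine DifferentiableAt.log
      (HasFDerivAt.finsetProd fun i _ => (d3 i).hasFDerivAt).differentiableAt ?_
    exact Finset.prod_ne_zero_iff.2 fun i _ => (hl i).ne'
  · refine DifferentiableAt.fun_sum fun i _ => DifferentiableAt.fun_sum fun j _ =>
      DifferentiableAt.pow ((d1 i j).sub ?_) 2
    exact DifferentiableAt.fun_sum fun k _ => ((d2 i k).mul (d3 k)).mul (d2 j k)

/-- A feasible point that is optimal in each block is stationary. -/
theorem Data.mem_stationary_of_blockwise (P : Data N M K) (hβ : 0 < P.β)
    (hd : DifferentiableOn ℝ P.g (Set.Ioi 0)) {𝒮 : Set (Matrix (Fin N) (Fin N) ℝ)} {x : Point N}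
    (hx : x ∈ P.feasible 𝒮) (h1 : IsMinOn (P.step1Obj x.2.1 x.2.2) 𝒮 x.1)
    (h2 : IsStep2 x.1 x.2.2 x.2.1) (h3 : IsMinOn (P.step3Obj x.1 x.2.1 x.2.2) P.spectra x.2.2) :
    x ∈ P.stationary 𝒮 := by
  refine ⟨hx, fun d hdx => ?_⟩
  have hl := hx.2.2.1
  have hQ := P.differentiableAt_smoothPart hl
  have hcg : HasFDerivAt (fun y : Point N => cg P.g y.2.2)
      ((fderiv ℝ (cg P.g) x.2.2).comp ((ContinuousLinearMap.snd ℝ _ _).comp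
        (ContinuousLinearMap.snd ℝ _ _))) x :=
    HasFDerivAt.comp (g := cg P.g) (f := fun y : Point N => y.2.2) x
      (differentiableAt_cg hd hl).hasFDerivAt (hasFDerivAt_snd (p := x)).snd
  have hmaj : HasFDerivAt (fun y : Point N => majorizer P.g y.2.2 x.2.2)
      ((fderiv ℝ (cg P.g) x.2.2).comp ((ContinuousLinearMap.snd ℝ _ _).comp
        (ContinuousLinearMap.snd ℝ _ _))) x :=
    (fderiv ℝ (cg P.g) x.2.2).hasFDerivAt.comp x (hasFDerivAt_snd (p := x)).snd
  have hG := hQ.hasFDerivAt.add (hcg.const_mul P.γ)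
  have hF := (hasFDerivAt_sum_partial hQ).add (hmaj.const_mul P.γ)
  -- The same functional is the differential at `x` of the smooth part of the objective and of its
  -- separable surrogate, because `c_g` and its majorizer agree to first order at `x`.
  set G' := fderiv ℝ P.smoothPart x + P.γ • ((fderiv ℝ (cg P.g) x.2.2).comp
    ((ContinuousLinearMap.snd ℝ _ _).comp (ContinuousLinearMap.snd ℝ _ _))) with hG'
  refine ⟨P.α * l1Dir x.1 d.1 + G' d, ?_, ?_⟩
  · obtain ⟨ι, F, hF0, c, e, he, hmem, hce⟩ := exists_fun_of_mem_tangentConeAt hdx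
    have hce' : Tendsto (fun n => (c n : ℝ) • e n) F (𝓝 d) := hce
    have t1 := tendsto_smul_l1Norm_sub (A := x.1) (fun n => (c n).coe_nonneg)
      ((continuous_fst.tendsto _).comp he) ((continuous_fst.tendsto _).comp hce')
    have t2 := hF.hasFDerivWithinAt.lim (s := Set.univ) he (by simp) hce'
    refine ge_of_tendsto ((t1.const_mul P.α).add t2) ?_
    filter_upwards [hmem] with n hn
    set y := x + e n with hy
    have hyl := hn.2.2.1
    -- The feasible set is a product, so each block of `y` competes alone against the corresponding
    -- block of `x`. The three inequalities are then added, scaled by `c n` and passed to the limit.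
    have b1 := isMinOn_iff.1 h1 _ hn.1
    have b2 := isMaxOn_iff.1 h2.2 _ hn.2.1
    have b3 := isMinOn_iff.1 h3 _ hn.2.2
    rw [P.step3Obj_eq hx.2.1, P.step3Obj_eq hx.2.1] at b3
    have b2' : P.β / 2 * frobSq (x.1 - x.2.1 * diagonal x.2.2 * x.2.1ᵀ)
        ≤ P.β / 2 * frobSq (x.1 - y.2.1 * diagonal x.2.2 * y.2.1ᵀ) := by
      rw [frobSq_sub_conj _ _ _ hx.2.1, frobSq_sub_conj _ _ _ hn.2.1]
      exact mul_le_mul_of_nonneg_left (by linarith) (by positivity)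
    have key : 0 ≤ P.α * (l1Norm y.1 - l1Norm x.1)
        + ((P.smoothPart (y.1, x.2.1, x.2.2) + P.smoothPart (x.1, y.2.1, x.2.2)
            + P.smoothPart (x.1, x.2.1, y.2.2) + P.γ * majorizer P.g y.2.2 x.2.2)
          - (P.smoothPart (x.1, x.2.1, x.2.2) + P.smoothPart (x.1, x.2.1, x.2.2)
            + P.smoothPart (x.1, x.2.1, x.2.2) + P.γ * majorizer P.g x.2.2 x.2.2)) := by
      simp only [smoothPart, log_det_diagonal hl, log_det_diagonal hyl]
      simp only [step1Obj] at b1 b3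
      linarith
    have := mul_nonneg (c n).coe_nonneg key
    refine this.trans_eq ?_
    have hy1 : x.1 + (e n).1 = y.1 := rfl
    simp only [smul_eq_mul, Pi.add_apply, Function.comp, hy1]
    ring
  · have hline : HasDerivAt (fun h : ℝ => x + h • d) d 0 := by
      have h := ((hasDerivAt_id (0 : ℝ)).smul_const d).const_add x
      rw [one_smul] at h
      exact h
    have hG0 : HasFDerivAt (P.smoothPart + fun y : Point N => P.γ * cg P.g y.2.2) G'
        (x + (0 : ℝ) • d) := by
      rw [zero_smul, add_zero]; exact hG
    have q := ((hasDerivWithinAt_l1Norm x.1 d.1).const_mul P.α).add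
      (hG0.comp_hasDerivAt (0 : ℝ) hline).hasDerivWithinAt
    refine q.congr_of_eventuallyEq (Eventually.of_forall fun h => ?_) ?_
    · simp only [objective, smoothPart, Pi.add_apply, Function.comp]
      simp only [Prod.fst_add, Prod.smul_fst]; ring
    · simp only [objective, smoothPart, Pi.add_apply, Function.comp]
      simp only [Prod.fst_add, Prod.smul_fst]; ring

end Stationarity

/-! ### Limit points and convergence from sufficient decrease. -/

theorem continuous_frobSq : Continuous (frobSq : Matrix (Fin N) (Fin N) ℝ → ℝ) :=
  continuous_finsetSum _ fun i _ => continuous_finsetSum _ fun j _ =>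
    (continuous_id.matrix_elem i j).pow 2

theorem continuous_l1Norm : Continuous (l1Norm : Matrix (Fin N) (Fin N) ℝ → ℝ) :=
  continuous_finsetSum _ fun i _ => continuous_finsetSum _ fun j _ =>
    (continuous_id.matrix_elem i j).abs

theorem continuous_pointDist (y : Point N) : Continuous fun x => pointDist x y := by
  refine Real.continuous_sqrt.comp (((continuous_frobSq.comp
    (continuous_fst.sub continuous_const)).add (continuous_frobSq.comp
    (continuous_snd.fst.sub continuous_const))).add (continuous_finsetSum _ fun i _ => ?_))
  exact (((continuous_apply i).comp continuous_snd.snd).sub continuous_const).pow 2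

theorem pointDist_self (y : Point N) : pointDist y y = 0 := by
  simp [pointDist, frobSq]

theorem tendsto_zero_of_sq {ι : Type*} {F : Filter ι} {u : ι → ℝ}
    (h : Tendsto (fun t => u t ^ 2) F (𝓝 0)) : Tendsto u F (𝓝 0) := by
  have := (Real.continuous_sqrt.tendsto 0).comp h
  simp only [Function.comp_def, Real.sqrt_sq_eq_abs, Real.sqrt_zero] at this
  exact (tendsto_zero_iff_abs_tendsto_zero u).2 this

theorem tendsto_zero_of_frobSq {ι : Type*} {F : Filter ι} {E : ι → Matrix (Fin N) (Fin N) ℝ}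
    (h : Tendsto (fun t => frobSq (E t)) F (𝓝 0)) : Tendsto E F (𝓝 0) := by
  refine tendsto_pi_nhds.2 fun i => tendsto_pi_nhds.2 fun j => ?_
  have hsq : Tendsto (fun t => E t i j ^ 2) F (𝓝 0) := by
    refine squeeze_zero (fun t => sq_nonneg _) (fun t => ?_) h
    exact (Finset.single_le_sum (f := fun j => E t i j ^ 2) (fun _ _ => sq_nonneg _)
        (Finset.mem_univ j)).trans
      (Finset.single_le_sum (f := fun i => ∑ j, E t i j ^ 2)
        (fun _ _ => Finset.sum_nonneg fun _ _ => sq_nonneg _) (Finset.mem_univ i))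
  exact tendsto_zero_of_sq hsq

/-- The initial point need not be feasible, nor its parameter `s` nonnegative; only the iterates
from index 1 on enter the descent argument. -/
theorem convergesToSet_of_shift {x : ℕ → Point N} {Y : Set (Point N)}
    (h : ConvergesToSet (fun t => x (t + 1)) Y) : ConvergesToSet x Y := by
  have hc : ∀ y, MapClusterPt y atTop (fun t => x (t + 1)) ↔ MapClusterPt y atTop x := fun y => by
    unfold MapClusterPt
    conv_rhs => rw [← map_add_atTop_eq_nat 1, Filter.map_map]
    rfl
  refine ⟨fun ε hε => ?_, ?_, fun y hy => h.2.2 y ((hc y).2 hy)⟩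
  · rw [← map_add_atTop_eq_nat 1]
    exact h.1 ε hε
  · obtain ⟨y, hy⟩ := h.2.1
    exact ⟨y, (hc y).1 hy⟩

/-- A sequence in a compact set all of whose limit points lie in `Y` converges to `Y`. -/
theorem convergesToSet_of_compact {x : ℕ → Point N} {Y Q : Set (Point N)} (hQ : IsCompact Q)
    (hx : ∀ t, x t ∈ Q) (hY : ∀ y, MapClusterPt y atTop x → y ∈ Y) : ConvergesToSet x Y := by
  refine ⟨fun ε hε => ?_, ?_, hY⟩
  · by_contra hne
    have hfr : ∃ᶠ t in atTop, ¬∃ y ∈ Y, pointDist (x t) y < ε := not_eventually.1 hne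
    -- Compactness yields a cluster point along the indices that stay `ε`-far from `Y`. It lies in
    -- `Y`, a contradiction.
    have : NeBot (atTop ⊓ 𝓟 {t | ¬∃ y ∈ Y, pointDist (x t) y < ε}) :=
      frequently_iff_neBot.1 hfr
    obtain ⟨y, -, hy⟩ := hQ.exists_mapClusterPt
      (f := atTop ⊓ 𝓟 {t | ¬∃ y ∈ Y, pointDist (x t) y < ε}) (u := x)
      (tendsto_principal.2 (Eventually.of_forall hx))
    obtain ⟨U, hU, hxU⟩ := mapClusterPt_iff_ultrafilter.1 hy
    have hyY := hY y (mapClusterPt_iff_ultrafilter.2 ⟨U, hU.trans inf_le_left, hxU⟩)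
    have h0 : Tendsto (fun t => pointDist (x t) y) U (𝓝 0) := by
      have := ((continuous_pointDist y).tendsto y).comp hxU
      rwa [pointDist_self] at this
    have h1 : ∀ᶠ t in (U : Filter ℕ), ¬∃ y ∈ Y, pointDist (x t) y < ε :=
      hU (mem_inf_of_right (mem_principal_self _))
    obtain ⟨t, ht, ht'⟩ := ((h0.eventually (gt_mem_nhds hε)).and h1).exists
    exact ht' ⟨y, hyY, ht⟩
  · obtain ⟨y, -, hy⟩ := hQ.exists_mapClusterPt (f := atTop) (u := x)
      (tendsto_principal.2 (Eventually.of_forall hx))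
    exact ⟨y, hy⟩

namespace Data

variable (P : Data N M K)

theorem tendsto_step1Obj {ι : Type*} {F : Filter ι} {V S : ι → Matrix (Fin N) (Fin N) ℝ}
    {l : ι → Fin N → ℝ} {V₀ S₀ : Matrix (Fin N) (Fin N) ℝ} {l₀ : Fin N → ℝ}
    (hV : Tendsto V F (𝓝 V₀)) (hl : Tendsto l F (𝓝 l₀)) (hS : Tendsto S F (𝓝 S₀)) :
    Tendsto (fun t => P.step1Obj (V t) (l t) (S t)) F (𝓝 (P.step1Obj V₀ l₀ S₀)) := by
  have hc : Continuous fun y : Point N => P.step1Obj y.2.1 y.2.2 y.1 := by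
    unfold step1Obj
    refine ((continuous_const.matrix_mul continuous_fst).matrix_trace.add
      (continuous_const.mul (continuous_l1Norm.comp continuous_fst))).add
      (continuous_const.mul (continuous_frobSq.comp (continuous_fst.sub ?_)))
    exact (continuous_snd.fst.matrix_mul continuous_snd.snd.matrix_diagonal).matrix_mul
      continuous_snd.fst.matrix_transpose
  have hp : Tendsto (fun t => ((S t, V t, l t) : Point N)) F (𝓝 (S₀, V₀, l₀)) :=
    hS.prodMk_nhds (hV.prodMk_nhds hl)
  have h := (hc.tendsto (S₀, V₀, l₀)).comp hp
  exact h

theorem tendsto_step3Obj (hc : ConcaveOn ℝ (Set.Ioi 0) P.g)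
    (hd : DifferentiableOn ℝ P.g (Set.Ioi 0)) {ι : Type*} {F : Filter ι}
    {V S : ι → Matrix (Fin N) (Fin N) ℝ} {u l : ι → Fin N → ℝ}
    {V₀ S₀ : Matrix (Fin N) (Fin N) ℝ} {u₀ l₀ : Fin N → ℝ}
    (hu₀ : ∀ i, 0 < u₀ i) (hl₀ : ∀ i, 0 < l₀ i)
    (hS : Tendsto S F (𝓝 S₀)) (hV : Tendsto V F (𝓝 V₀))
    (hu : Tendsto u F (𝓝 u₀)) (hl : Tendsto l F (𝓝 l₀)) :
    Tendsto (fun t => P.step3Obj (S t) (V t) (u t) (l t)) F (𝓝 (P.step3Obj S₀ V₀ u₀ l₀)) := by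
  have hl' := tendsto_pi_nhds.1 hl
  have hB : Tendsto (fun t => (V t)ᵀ * S t * V t) F (𝓝 (V₀ᵀ * S₀ * V₀)) := by
    have hcont : Continuous fun p : Matrix (Fin N) (Fin N) ℝ × Matrix (Fin N) (Fin N) ℝ =>
        p.1ᵀ * p.2 * p.1 :=
      (continuous_fst.matrix_transpose.matrix_mul continuous_snd).matrix_mul continuous_fst
    have hp : Tendsto (fun t => (V t, S t)) F (𝓝 (V₀, S₀)) := hV.prodMk_nhds hS
    have h := (hcont.tendsto (V₀, S₀)).comp hp
    exact h
  unfold step3Obj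
  refine Tendsto.add (Tendsto.add (tendsto_finsetSum _ fun j _ => ?_).neg
    (Tendsto.const_mul _ (tendsto_finsetSum _ fun j _ => ?_)))
    (Tendsto.const_mul _ (tendsto_majorizer hc hd hu₀ hu hl))
  · exact (hl' j).log (hl₀ j).ne'
  · exact ((hl' j).sub (tendsto_pi_nhds.1 (tendsto_pi_nhds.1 hB j) j)).pow 2

/-- Convergence of a three-block scheme of feasible iterates, given sufficient decrease in the first
block and optimality of its limits. -/
theorem convergesToSet_of_sufficient_decrease (hα : 0 < P.α) (hβ : 0 < P.β) (hγ : 0 ≤ P.γ)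
    (hc : ConcaveOn ℝ (Set.Ioi 0) P.g) (hd : DifferentiableOn ℝ P.g (Set.Ioi 0))
    {𝒮 : Set (Matrix (Fin N) (Fin N) ℝ)} (hclosed : IsClosed 𝒮) {x : ℕ → Point N}
    (hx : ∀ t, x t ∈ P.feasible 𝒮)
    (h1 : ∀ t, P.step1Obj (x t).2.1 (x t).2.2 (x (t + 1)).1
      + P.β / 4 * frobSq ((x (t + 1)).1 - (x t).1) ≤ P.step1Obj (x t).2.1 (x t).2.2 (x t).1)
    (h2 : ∀ t, IsStep2 (x (t + 1)).1 (x t).2.2 (x (t + 1)).2.1)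
    (h3 : ∀ t, P.IsStep3 (x (t + 1)).1 (x (t + 1)).2.1 (x t).2.2 (x (t + 1)).2.2)
    (hlim : ∀ (F : Filter ℕ) (y : Point N), F.NeBot → Tendsto x F (𝓝 y) →
      Tendsto (fun t => (x (t + 1)).1) F (𝓝 y.1) →
      IsMinOn (P.step1Obj y.2.1 y.2.2) 𝒮 y.1) :
    ConvergesToSet x (P.stationary 𝒮) := by
  have hdesc := fun t => P.objective_descent hβ hγ hc hd (hx t) (h1 t) (h2 t) (h3 t)
  have hgap : ∀ t, 0 ≤ frobSq ((x (t + 1)).1 - (x t).1)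
      + ∑ j, ((x (t + 1)).2.2 j - (x t).2.2 j) ^ 2 := fun t =>
    add_nonneg (frobSq_nonneg _) (Finset.sum_nonneg fun _ _ => sq_nonneg _)
  have hanti : Antitone fun t => P.objective (x t) := antitone_nat_of_succ_le fun t => by
    have := mul_nonneg (by positivity : 0 ≤ P.β / 4) (hgap t)
    linarith [hdesc t]
  obtain ⟨b, hb⟩ := P.exists_objective_lower_bound hα hβ hγ
  have hbdd : BddBelow (Set.range fun t => P.objective (x t)) :=
    ⟨b, by rintro _ ⟨t, rfl⟩; exact hb 𝒮 _ (hx t)⟩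
  have hconv := tendsto_atTop_ciInf hanti hbdd
  have hgap0 : Tendsto (fun t => frobSq ((x (t + 1)).1 - (x t).1)
      + ∑ j, ((x (t + 1)).2.2 j - (x t).2.2 j) ^ 2) atTop (𝓝 0) := by
    have hdiff := (hconv.sub (hconv.comp (tendsto_add_atTop_nat 1))).const_mul (4 / P.β)
    rw [sub_self, mul_zero] at hdiff
    refine squeeze_zero hgap (fun t => ?_) hdiff
    rw [div_mul_eq_mul_div, le_div_iff₀ hβ]
    simp only [Function.comp]
    linarith [hdesc t]
  have hS0 : Tendsto (fun t => (x (t + 1)).1 - (x t).1) atTop (𝓝 0) :=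
    tendsto_zero_of_frobSq (squeeze_zero (fun _ => frobSq_nonneg _)
      (fun t => le_add_of_nonneg_right (Finset.sum_nonneg fun _ _ => sq_nonneg _)) hgap0)
  have hl0 : Tendsto (fun t => (x (t + 1)).2.2 - (x t).2.2) atTop (𝓝 0) := by
    refine tendsto_pi_nhds.2 fun j => ?_
    have hsq : Tendsto (fun t => ((x (t + 1)).2.2 j - (x t).2.2 j) ^ 2) atTop (𝓝 0) := by
      refine squeeze_zero (fun _ => sq_nonneg _) (fun t => ?_) hgap0
      exact (Finset.single_le_sum (f := fun j => ((x (t + 1)).2.2 j - (x t).2.2 j) ^ 2)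
        (fun _ _ => sq_nonneg _) (Finset.mem_univ j)).trans
        (le_add_of_nonneg_left (frobSq_nonneg _))
    exact tendsto_zero_of_sq hsq
  obtain ⟨Q, hQ, hQpos, hQmem⟩ := P.exists_compact_sublevel hα hβ hγ (P.objective (x 0))
  have hxQ : ∀ t, x t ∈ Q := fun t => hQmem 𝒮 _ (hx t) (hanti (Nat.zero_le t))
  refine convergesToSet_of_compact hQ hxQ fun y hy => ?_
  -- The limit is taken along `x (t + 1)`, so that Steps 2 and 3 that produced it, from `x t`, are
  -- available.
  have hy' : MapClusterPt y atTop fun t => x (t + 1) := by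
    unfold MapClusterPt at hy ⊢
    rw [← map_add_atTop_eq_nat 1, Filter.map_map] at hy
    exact hy
  obtain ⟨U, hU, hxU⟩ := mapClusterPt_iff_ultrafilter.1 hy'
  have hSU := (continuous_fst.tendsto y).comp hxU
  have hVU := ((continuous_fst.comp continuous_snd).tendsto y).comp hxU
  have hlU := ((continuous_snd.comp continuous_snd).tendsto y).comp hxU
  simp only [Function.comp_def] at hSU hVU hlU
  -- Steps 2 and 3 at `t + 1` use the old spectrum; since `Δl → 0` it has the same limit as the new
  -- one.
  have hlU' : Tendsto (fun t => (x t).2.2) U (𝓝 y.2.2) := by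
    simpa using hlU.sub (hl0.mono_left hU)
  have hSU' : Tendsto (fun t => (x (t + 1 + 1)).1) U (𝓝 y.1) := by
    simpa using ((hS0.comp (tendsto_add_atTop_nat 1)).mono_left hU).add hSU
  have hyl : ∀ i, 0 < y.2.2 i :=
    hQpos y (hQ.isClosed.mem_of_tendsto hxU (Eventually.of_forall fun t => hxQ _))
  have hcgU := (differentiableAt_cg hd hyl).continuousAt.tendsto.comp hlU
  have hyV : y.2.1ᵀ * y.2.1 = 1 := by
    have hcont : Continuous fun V : Matrix (Fin N) (Fin N) ℝ => Vᵀ * V :=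
      continuous_id.matrix_transpose.matrix_mul continuous_id
    have := (hcont.tendsto _).comp hVU
    exact tendsto_nhds_unique this (tendsto_const_nhds.congr fun t => (hx (t + 1)).2.1.symm)
  have hyf : y ∈ P.feasible 𝒮 :=
    ⟨hclosed.mem_of_tendsto hSU (Eventually.of_forall fun t => (hx _).1), hyV, hyl,
      ge_of_tendsto hcgU (Eventually.of_forall fun t => (hx (t + 1)).2.2.2)⟩
  refine P.mem_stationary_of_blockwise hβ hd hyf ?_ ⟨hyV, ?_⟩ ?_
  · exact hlim (map (· + 1) (U : Filter ℕ)) y inferInstance (tendsto_map'_iff.2 hxU)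
      (tendsto_map'_iff.2 hSU')
  · have hcont : ∀ W : ℕ → Matrix (Fin N) (Fin N) ℝ, ∀ W₀, Tendsto W U (𝓝 W₀) →
        Tendsto (fun t => trace ((W t)ᵀ * (x (t + 1)).1 * W t * diagonal (x t).2.2)) U
          (𝓝 (trace (W₀ᵀ * y.1 * W₀ * diagonal y.2.2))) := fun W W₀ hW => by
      have hc' : Continuous fun z : Point N => trace (z.2.1ᵀ * z.1 * z.2.1 * diagonal z.2.2) :=
        (((continuous_snd.fst.matrix_transpose.matrix_mul continuous_fst).matrix_mul
          continuous_snd.fst).matrix_mul continuous_snd.snd.matrix_diagonal).matrix_trace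
      have hp : Tendsto (fun t => (((x (t + 1)).1, W t, (x t).2.2) : Point N)) U
          (𝓝 (y.1, W₀, y.2.2)) := hSU.prodMk_nhds (hW.prodMk_nhds hlU')
      have h := (hc'.tendsto (y.1, W₀, y.2.2)).comp hp
      exact h
    refine isMaxOn_iff.2 fun W hW => ?_
    exact le_of_tendsto_of_tendsto' (hcont (fun _ => W) W tendsto_const_nhds)
      (hcont _ _ hVU) fun t => isMaxOn_iff.1 (h2 t).2 W hW
  · refine isMinOn_iff.2 fun l hl => ?_
    exact le_of_tendsto_of_tendsto'
      (P.tendsto_step3Obj hc hd hyl hyl hSU hVU hlU' hlU)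
      (P.tendsto_step3Obj hc hd hyl hl.1 hSU hVU hlU' tendsto_const_nhds)
      fun t => isMinOn_iff.1 (h3 t).2 l hl

/-- Convergence of the scheme with exact first step. -/
theorem IsExactRun.convergesToSet (hα : 0 < P.α) (hβ : 0 < P.β) (hγ : 0 ≤ P.γ)
    (hc : ConcaveOn ℝ (Set.Ioi 0) P.g) (hd : DifferentiableOn ℝ P.g (Set.Ioi 0))
    {𝒮 : Set (Matrix (Fin N) (Fin N) ℝ)} (hclosed : IsClosed 𝒮) (hconv : Convex ℝ 𝒮)
    {x : ℕ → Point N} (hx : P.IsExactRun 𝒮 x) : ConvergesToSet x (P.stationary 𝒮) := by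
  obtain ⟨-, hx⟩ := hx
  have hf : ∀ t, x (t + 1) ∈ P.feasible 𝒮 := fun t =>
    ⟨(hx t).1.1, (hx t).2.1.1, (hx t).2.2.1⟩
  refine convergesToSet_of_shift (P.convergesToSet_of_sufficient_decrease hα hβ hγ hc hd hclosed hf
    (fun t => P.exactStep1_growth hα hβ hconv (hx (t + 1)).1 (hf t).1)
    (fun t => (hx (t + 1)).2.1) (fun t => (hx (t + 1)).2.2) ?_)
  intro F y _ hxF hSF
  have hVF := ((continuous_fst.comp continuous_snd).tendsto y).comp hxF
  have hlF := ((continuous_snd.comp continuous_snd).tendsto y).comp hxF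
  exact isMinOn_iff.2 fun S hS => le_of_tendsto_of_tendsto' (P.tendsto_step1Obj hVF hlF hSF)
    (P.tendsto_step1Obj hVF hlF tendsto_const_nhds)
    fun t => isMinOn_iff.1 (hx (t + 1)).1.2 S hS

end Data

/-! ### The projected-gradient first step. -/

namespace Data

variable {m : ℕ} (P : Data N M K) {𝓢 : (Fin m → ℝ) →ₗ[ℝ] Matrix (Fin N) (Fin N) ℝ}
  {H : Matrix (Fin N) (Fin N) ℝ}

theorem sum_adj_mul (Y : Matrix (Fin N) (Fin N) ℝ) (s : Fin m → ℝ) :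
    ∑ k, adj 𝓢 Y k * s k = ∑ i, ∑ j, 𝓢 s i j * Y i j := by
  have hs : 𝓢 s = ∑ k, s k • 𝓢 (Pi.single k 1) := by
    conv_lhs => rw [pi_eq_sum_univ' s]
    simp [map_sum, map_smul]
  simp only [hs, Matrix.sum_apply, Matrix.smul_apply, smul_eq_mul, adj, Finset.sum_mul]
  rw [Finset.sum_comm]
  refine Finset.sum_congr rfl fun i _ => ?_
  rw [Finset.sum_comm]
  exact Finset.sum_congr rfl fun j _ => Finset.sum_congr rfl fun k _ => by ring

theorem continuous_adj : Continuous (adj 𝓢) :=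
  continuous_pi fun _ => continuous_finsetSum _ fun i _ => continuous_finsetSum _ fun j _ =>
    continuous_const.mul (continuous_id.matrix_elem i j)

theorem continuous_param : Continuous 𝓢 := LinearMap.continuous_of_finiteDimensional 𝓢

theorem bddAbove_frobSq_sphere (𝓢 : (Fin m → ℝ) →ₗ[ℝ] Matrix (Fin N) (Fin N) ℝ) :
    BddAbove {r | ∃ s : Fin m → ℝ, ∑ k, s k ^ 2 = 1 ∧ r = frobSq (𝓢 s)} := by
  have hbox : IsCompact (Set.univ.pi fun _ : Fin m => Set.Icc (-1 : ℝ) 1) :=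
    isCompact_univ_pi fun _ => isCompact_Icc
  refine (hbox.image (continuous_frobSq.comp (continuous_param (𝓢 := 𝓢)))).bddAbove.mono ?_
  rintro _ ⟨s, hs, rfl⟩
  refine ⟨s, fun k _ => abs_le.1 ?_, rfl⟩
  rw [← sq_le_one_iff_abs_le_one, ← hs]
  exact Finset.single_le_sum (f := fun k => s k ^ 2) (fun _ _ => sq_nonneg _) (Finset.mem_univ k)

theorem frobSq_smul (c : ℝ) (A : Matrix (Fin N) (Fin N) ℝ) :
    frobSq (c • A) = c ^ 2 * frobSq A := by
  simp only [frobSq, Matrix.smul_apply, smul_eq_mul, mul_pow, Finset.mul_sum]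

theorem frobSq_param_le (s : Fin m → ℝ) : frobSq (𝓢 s) ≤ opNormSq 𝓢 * ∑ k, s k ^ 2 := by
  have hnn : 0 ≤ ∑ k, s k ^ 2 := Finset.sum_nonneg fun _ _ => sq_nonneg _
  rcases hnn.eq_or_lt with h0 | hpos
  · have hs : s = 0 := funext fun k => by
      simpa using (Finset.sum_eq_zero_iff_of_nonneg fun _ _ => sq_nonneg _).1 h0.symm k
        (Finset.mem_univ k)
    simp [hs, frobSq]
  · set c := √(∑ k, s k ^ 2) with hc
    have hc0 : 0 < c := Real.sqrt_pos.2 hpos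
    have hc2 : c ^ 2 = ∑ k, s k ^ 2 := Real.sq_sqrt hnn
    have h1 : ∑ k, (c⁻¹ • s) k ^ 2 = 1 := by
      simp only [Pi.smul_apply, smul_eq_mul, mul_pow, ← Finset.mul_sum, ← hc2]
      field_simp
    have h2 : frobSq (𝓢 (c⁻¹ • s)) ≤ opNormSq 𝓢 :=
      le_csSup (bddAbove_frobSq_sphere 𝓢) ⟨_, h1, rfl⟩
    rw [map_smul, frobSq_smul, inv_pow, inv_mul_le_iff₀ (by positivity)] at h2
    rw [← hc2, mul_comm]
    exact h2

/-- Injectivity makes the image of a unit vector nonzero. For `m = 0` the supremum runs over the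
empty set and takes the default value `0`. -/
theorem opNormSq_pos [Nonempty (Fin m)] (hinj : Function.Injective 𝓢) : 0 < opNormSq 𝓢 := by
  obtain ⟨k⟩ := ‹Nonempty (Fin m)›
  have hne : 𝓢 (Pi.single k 1) ≠ 0 := fun h => by
    have := hinj (h.trans (map_zero 𝓢).symm)
    simpa using congrFun this k
  obtain ⟨i, j, hij⟩ : ∃ i j, 𝓢 (Pi.single k 1) i j ≠ 0 := by
    by_contra hcon
    push Not at hcon
    exact hne (Matrix.ext hcon)
  have hpos : 0 < frobSq (𝓢 (Pi.single k 1)) :=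
    Finset.sum_pos' (fun _ _ => Finset.sum_nonneg fun _ _ => sq_nonneg _)
      ⟨i, Finset.mem_univ i, Finset.sum_pos' (fun _ _ => sq_nonneg _)
        ⟨j, Finset.mem_univ j, by positivity⟩⟩
  have h := frobSq_param_le (𝓢 := 𝓢) (Pi.single k 1)
  have h1 : ∑ i, (Pi.single k (1 : ℝ) : Fin m → ℝ) i ^ 2 = 1 := by
    simp [Pi.single_apply, ite_pow]
  rw [h1, mul_one] at h
  exact hpos.trans_le h

theorem trace_mul_eq_sum_of_isSymm {A : Matrix (Fin N) (Fin N) ℝ} (hA : A.IsSymm)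
    (B : Matrix (Fin N) (Fin N) ℝ) : trace (A * B) = ∑ i, ∑ j, A i j * B i j := by
  simp only [trace, diag_apply, mul_apply]
  rw [Finset.sum_comm]
  exact Finset.sum_congr rfl fun i _ => Finset.sum_congr rfl fun j _ => by rw [hA.apply]

/-- Exact second-order expansion of the first-block objective along the parametrization. -/
theorem step1Obj_param_sub (hβ : 0 < P.β) (hsymm : ∀ s, (𝓢 s).IsSymm)
    (hH : ∀ s : Fin m → ℝ, (∀ k, 0 ≤ s k) → l1Norm (𝓢 s) = trace (𝓢 s * H))
    (V : Matrix (Fin N) (Fin N) ℝ) (l : Fin N → ℝ) {s s' : Fin m → ℝ}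
    (hs : ∀ k, 0 ≤ s k) (hs' : ∀ k, 0 ≤ s' k) :
    P.step1Obj V l (𝓢 s') - P.step1Obj V l (𝓢 s)
      = P.β * ∑ k, (adj 𝓢 (𝓢 s) k - P.zVec 𝓢 H V l k) * (s' k - s k)
        + P.β / 2 * frobSq (𝓢 (s' - s)) := by
  have e : ∑ k, (adj 𝓢 (𝓢 s) k - P.zVec 𝓢 H V l k) * (s' k - s k)
      = ∑ k, adj 𝓢 (𝓢 s) k * (s' - s) k
        - ∑ k, adj 𝓢 (V * diagonal l * Vᵀ - P.β⁻¹ • (empCov P.X + P.α • H)) k * (s' - s) k := by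
    rw [← Finset.sum_sub_distrib]
    exact Finset.sum_congr rfl fun k _ => by simp only [zVec, Pi.sub_apply]; ring
  rw [e, sum_adj_mul, sum_adj_mul, map_sub]
  -- On nonnegative parameters the `ℓ¹` norm is linear, so the objective is quadratic. Symmetry of
  -- `𝓢 s` turns the traces into entrywise inner products.
  simp only [step1Obj, hH s hs, hH s' hs', trace_mul_comm (empCov P.X),
    trace_mul_eq_sum_of_isSymm (hsymm _), frobSq]
  generalize V * diagonal l * Vᵀ = B
  simp only [Finset.mul_sum, ← Finset.sum_add_distrib, ← Finset.sum_sub_distrib]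
  refine Finset.sum_congr rfl fun i _ => Finset.sum_congr rfl fun j _ => ?_
  simp only [Matrix.sub_apply, Matrix.smul_apply, Matrix.add_apply, smul_eq_mul]
  field_simp
  ring

theorem gradStep1_nonneg (V : Matrix (Fin N) (Fin N) ℝ) (l : Fin N → ℝ) (s : Fin m → ℝ)
    (k : Fin m) : 0 ≤ P.gradStep1 𝓢 H V l s k :=
  le_max_right _ _

/-- With `p` the projection of `s - G/L` onto the orthant and `L = ‖𝓢‖²`, the projection inequality
gives `⟨G, p - s⟩ ≤ -L ‖p - s‖² ≤ -‖𝓢 (p - s)‖²`. The exact expansion then yields a decrease of `β/2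
‖𝓢 (p - s)‖²`, more than the `β/4` that the exact step provides. -/
theorem gradStep1_decrease (hβ : 0 < P.β) (hinj : Function.Injective 𝓢)
    (hsymm : ∀ s, (𝓢 s).IsSymm)
    (hH : ∀ s : Fin m → ℝ, (∀ k, 0 ≤ s k) → l1Norm (𝓢 s) = trace (𝓢 s * H))
    (V : Matrix (Fin N) (Fin N) ℝ) (l : Fin N → ℝ) {s : Fin m → ℝ} (hs : ∀ k, 0 ≤ s k) :
    P.step1Obj V l (𝓢 (P.gradStep1 𝓢 H V l s))
      + P.β / 4 * frobSq (𝓢 (P.gradStep1 𝓢 H V l s) - 𝓢 s) ≤ P.step1Obj V l (𝓢 s) := by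
  have hexp := P.step1Obj_param_sub hβ hsymm hH V l hs
    (P.gradStep1_nonneg (𝓢 := 𝓢) (H := H) V l s)
  set p := P.gradStep1 𝓢 H V l s with hp
  have hle := frobSq_param_le (𝓢 := 𝓢) (p - s)
  have hlin : ∑ k, (adj 𝓢 (𝓢 s) k - P.zVec 𝓢 H V l k) * (p k - s k)
      ≤ -(opNormSq 𝓢 * ∑ k, (p - s) k ^ 2) := by
    rcases isEmpty_or_nonempty (Fin m) with hm | hm
    · simp
    have hL := opNormSq_pos hinj
    rw [Finset.mul_sum, ← Finset.sum_neg_distrib]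
    refine Finset.sum_le_sum fun k _ => ?_
    have hpk : p k = max (s k - 1 / opNormSq 𝓢 * (adj 𝓢 (𝓢 s) k - P.zVec 𝓢 H V l k)) 0 := rfl
    have hsk := hs k
    generalize adj 𝓢 (𝓢 s) k - P.zVec 𝓢 H V l k = G at hpk
    generalize opNormSq 𝓢 = L at hL hpk
    simp only [Pi.sub_apply]
    have hG : G = L * (1 / L * G) := by field_simp
    generalize 1 / L * G = w at hG hpk
    subst hG
    rcases le_total (s k - w) 0 with h | h
    · rw [max_eq_right h] at hpk
      rw [hpk]
      nlinarith [mul_nonneg hL.le (mul_nonneg hsk (by linarith : 0 ≤ w - s k))]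
    · rw [max_eq_left h] at hpk
      rw [hpk]
      exact le_of_eq (by ring)
  rw [← map_sub]
  have h1 := mul_le_mul_of_nonneg_left hlin hβ.le
  have h2 := mul_le_mul_of_nonneg_left hle hβ.le
  have h3 := mul_nonneg hβ.le (frobSq_nonneg (𝓢 (p - s)))
  linarith

/-- A fixed point of the projected-gradient update minimizes the first-block objective. -/
theorem isMinOn_of_gradStep1_eq (hβ : 0 < P.β) (hinj : Function.Injective 𝓢)
    (hsymm : ∀ s, (𝓢 s).IsSymm)
    (hH : ∀ s : Fin m → ℝ, (∀ k, 0 ≤ s k) → l1Norm (𝓢 s) = trace (𝓢 s * H))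
    {V : Matrix (Fin N) (Fin N) ℝ} {l : Fin N → ℝ} {s : Fin m → ℝ}
    (hfix : P.gradStep1 𝓢 H V l s = s) : IsMinOn (P.step1Obj V l) (cone 𝓢) (𝓢 s) := by
  have hs : ∀ k, 0 ≤ s k := fun k => hfix ▸ P.gradStep1_nonneg V l s k
  refine isMinOn_iff.2 ?_
  rintro _ ⟨s', hs', rfl⟩
  have hs' : ∀ k, 0 ≤ s' k := hs'
  have hexp := P.step1Obj_param_sub hβ hsymm hH V l hs hs'
  -- The fixed-point equation is the complementarity condition: each gradient coordinate is
  -- nonnegative, and zero where `s k > 0`.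
  have hlin : 0 ≤ ∑ k, (adj 𝓢 (𝓢 s) k - P.zVec 𝓢 H V l k) * (s' k - s k) := by
    refine Finset.sum_nonneg fun k _ => ?_
    have : Nonempty (Fin m) := ⟨k⟩
    have hL := opNormSq_pos hinj
    have hk : max (s k - 1 / opNormSq 𝓢 * (adj 𝓢 (𝓢 s) k - P.zVec 𝓢 H V l k)) 0 = s k :=
      congrFun hfix k
    generalize adj 𝓢 (𝓢 s) k - P.zVec 𝓢 H V l k = G at hk
    generalize opNormSq 𝓢 = L at hL hk
    have hG : G = L * (1 / L * G) := by field_simp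
    generalize 1 / L * G = w at hG hk
    subst hG
    have hsk' := hs' k
    rcases le_total (s k - w) 0 with h | h
    · rw [max_eq_right h] at hk
      rw [← hk] at h ⊢
      have : 0 ≤ w := by linarith
      simp only [sub_zero]
      positivity
    · rw [max_eq_left h] at hk
      have : w = 0 := by linarith
      simp [this]
  have h2 := mul_nonneg (half_pos hβ).le (frobSq_nonneg (𝓢 (s' - s)))
  have h3 := mul_nonneg hβ.le hlin
  linarith

theorem isClosed_cone (hinj : Function.Injective 𝓢) : IsClosed (cone 𝓢) := by
  refine (LinearMap.isClosedEmbedding_of_injective (LinearMap.ker_eq_bot.2 hinj)).isClosedMap _ ?_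
  have : {s : Fin m → ℝ | ∀ k, 0 ≤ s k} = ⋂ k, {s | 0 ≤ s k} := by ext; simp
  rw [this]
  exact isClosed_iInter fun k => isClosed_le continuous_const (continuous_apply k)

theorem continuous_gradStep1 : Continuous fun p : (Fin m → ℝ) × Matrix (Fin N) (Fin N) ℝ ×
    (Fin N → ℝ) => P.gradStep1 𝓢 H p.2.1 p.2.2 p.1 := by
  have hz : Continuous fun p : (Fin m → ℝ) × Matrix (Fin N) (Fin N) ℝ × (Fin N → ℝ) =>
      P.zVec 𝓢 H p.2.1 p.2.2 := by
    refine continuous_adj.comp (Continuous.sub ?_ continuous_const)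
    exact (continuous_snd.fst.matrix_mul continuous_snd.snd.matrix_diagonal).matrix_mul
      continuous_snd.fst.matrix_transpose
  have ha : Continuous fun p : (Fin m → ℝ) × Matrix (Fin N) (Fin N) ℝ × (Fin N → ℝ) =>
      adj 𝓢 (𝓢 p.1) := continuous_adj.comp (continuous_param.comp continuous_fst)
  refine continuous_pi fun k => Continuous.max (Continuous.sub ?_ (continuous_const.mul
    (Continuous.sub ?_ ?_))) continuous_const
  · exact (continuous_apply k).comp continuous_fst
  · exact (continuous_apply k).comp ha
  · exact (continuous_apply k).comp hz

/-- Convergence of the scheme with the projected-gradient first step. -/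
theorem IsGradRun.convergesToSet (hα : 0 < P.α) (hβ : 0 < P.β) (hγ : 0 ≤ P.γ)
    (hc : ConcaveOn ℝ (Set.Ioi 0) P.g) (hd : DifferentiableOn ℝ P.g (Set.Ioi 0))
    (hinj : Function.Injective 𝓢) (hsymm : ∀ s, (𝓢 s).IsSymm)
    (hH : ∀ s : Fin m → ℝ, (∀ k, 0 ≤ s k) → l1Norm (𝓢 s) = trace (𝓢 s * H))
    {s : ℕ → Fin m → ℝ} {x : ℕ → Point N} (hx : P.IsGradRun 𝓢 H s x) :
    ConvergesToSet x (P.stationary (cone 𝓢)) := by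
  obtain ⟨-, hx⟩ := hx
  have hs : ∀ t k, 0 ≤ s (t + 1) k := fun t k => by
    rw [(hx t).1]; exact P.gradStep1_nonneg _ _ _ _
  have hf : ∀ t, x (t + 1) ∈ P.feasible (cone 𝓢) := fun t =>
    ⟨⟨s (t + 1), hs t, (hx t).2.1.symm⟩, (hx t).2.2.1.1, (hx t).2.2.2.1⟩
  refine convergesToSet_of_shift (P.convergesToSet_of_sufficient_decrease hα hβ hγ hc hd
    (isClosed_cone hinj) hf (fun t => ?_)
    (fun t => (hx (t + 1)).2.2.1) (fun t => (hx (t + 1)).2.2.2) ?_)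
  · rw [(hx (t + 1)).2.1, (hx (t + 1)).1, (hx t).2.1]
    exact P.gradStep1_decrease hβ hinj hsymm hH _ _ (hs t)
  · intro F y _ hxF hSF
    have hVF := ((continuous_fst.comp continuous_snd).tendsto y).comp hxF
    have hlF := ((continuous_snd.comp continuous_snd).tendsto y).comp hxF
    have hSF₀ := (continuous_fst.tendsto y).comp hxF
    simp only [Function.comp_def, (hx _).2.1] at hSF₀ hSF hVF hlF
    -- A linear left inverse recovers `s` continuously from `S`, so `s (t + 1)` and `s (t + 2)`
    -- share a limit, which continuity of the update makes a fixed point.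
    obtain ⟨R, hR⟩ := 𝓢.exists_leftInverse_of_injective (LinearMap.ker_eq_bot.2 hinj)
    have hRs : ∀ u, R (𝓢 u) = u := fun u => LinearMap.congr_fun hR u
    have hRc : Continuous R := LinearMap.continuous_of_finiteDimensional R
    have hs0 : Tendsto (fun t => s (t + 1)) F (𝓝 (R y.1)) :=
      ((hRc.tendsto y.1).comp hSF₀).congr fun t => hRs _
    have hs1 : Tendsto (fun t => s (t + 1 + 1)) F (𝓝 (R y.1)) :=
      ((hRc.tendsto y.1).comp hSF).congr fun t => hRs _
    have hy : 𝓢 (R y.1) = y.1 :=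
      tendsto_nhds_unique ((continuous_param.tendsto (R y.1)).comp hs0) hSF₀
    have hp : Tendsto (fun t => (s (t + 1), (x (t + 1)).2.1, (x (t + 1)).2.2)) F
        (𝓝 (R y.1, y.2.1, y.2.2)) := hs0.prodMk_nhds (hVF.prodMk_nhds hlF)
    have hg := ((P.continuous_gradStep1 (𝓢 := 𝓢) (H := H)).tendsto _).comp hp
    have hfix : P.gradStep1 𝓢 H y.2.1 y.2.2 (R y.1) = R y.1 :=
      tendsto_nhds_unique hg (hs1.congr fun t => (hx (t + 1)).1)
    have hmin := P.isMinOn_of_gradStep1_eq hβ hinj hsymm hH hfix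
    rwa [hy] at hmin

end Data

end MotifGL

theorem proposition1 {N M K : ℕ} (P : MotifGL.Data N M K)
    (hα : 0 < P.α) (hβ : 0 < P.β) (hγ : 0 ≤ P.γ)
    (hconc : ConcaveOn ℝ (Set.Ioi 0) P.g) (hdiff : DifferentiableOn ℝ P.g (Set.Ioi 0)) :
    -- Step 1 solved exactly, over a closed convex set of symmetric shift operators
    (∀ 𝒮 : Set (Matrix (Fin N) (Fin N) ℝ), IsClosed 𝒮 → Convex ℝ 𝒮 → (∀ S ∈ 𝒮, S.IsSymm) →
      ∀ x : ℕ → MotifGL.Point N, P.IsExactRun 𝒮 x →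
        MotifGL.ConvergesToSet x (P.stationary 𝒮)) ∧
    -- Step 1 by the projected-gradient update
    (∀ (m : ℕ) (𝓢 : (Fin m → ℝ) →ₗ[ℝ] Matrix (Fin N) (Fin N) ℝ)
      (H : Matrix (Fin N) (Fin N) ℝ), Function.Injective 𝓢 → (∀ s, (𝓢 s).IsSymm) →
      (∀ s : Fin m → ℝ, (∀ k, 0 ≤ s k) → MotifGL.l1Norm (𝓢 s) = Matrix.trace (𝓢 s * H)) →
      ∀ (s : ℕ → Fin m → ℝ) (x : ℕ → MotifGL.Point N), P.IsGradRun 𝓢 H s x →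
        MotifGL.ConvergesToSet x (P.stationary (MotifGL.Data.cone 𝓢))) := by
  refine ⟨fun 𝒮 hclosed hconv _ x hx => ?_, fun m 𝓢 H hinj hsymm hH s x hx => ?_⟩
  · exact MotifGL.Data.IsExactRun.convergesToSet P hα hβ hγ hconc hdiff hclosed hconv hx
  · exact MotifGL.Data.IsGradRun.convergesToSet P hα hβ hγ hconc hdiff hinj hsymm hH hx
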